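/- Let $N\ge 1$. On pairs $(B,C)$ of complex $N\times N$ matrices, with entries $b_{i,j}$ and $c_{i,j}$, consider the Poisson–Lie brackets $$\{B\overset{\otimes}{,}B\}=r_{12}(B\otimes B)-(B\otimes B)r_{12},\quad \{C\overset{\otimes}{,}C\}=r_{12}(C\otimes C)-(C\otimes C)r_{12},\quad \{C\overset{\otimes}{,}B\}=r_{12}(C\otimes B)-(C\otimes B)r_{12},$$ $$r_{12}=\sum_i E_{i,i}\otimes E_{i,i}+2\sum_{i>j}E_{i,j}\otimes E_{j,i},$$ where $\{X_{i,j},Y_{k,l}\}$ is the entry of $\{X\overset{\otimes}{,}Y\}$ in row $(i,k)$ and column $(j,l)$. The brackets are extended to the field of rational functions of the $2N^2$ variables $b_{i,j},c_{i,j}$ by antisymmetry, bilinearity over $\mathbb C$ and the Leibniz rule. A Casimir function is a rational function whose bracket with every rational function vanishes. Let $M^-_d(B)$ be the $d\times d$ minor in the bottom-left corner of $B$ (rows $N-d+1,\dots,N$ and columns $1,\dots,d$), and let $M^+_d(C)$ be the $d\times d$ minor in the upper-right corner of $C$ (rows $1,\dots,d$ and columns $N-d+1,\dots,N$), with $M^\pm_0=1$.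 Then: 1. for $d=0,1,\dots,N$ the function $M^-_d(B)/M^+_{N-d}(C)$ is a Casimir function; 2. for $s=0,1,\dots,N$ the coefficient $q_s$ of $\lambda^s$ in $\det(B+\lambda C)$ is a Casimir function; 3. $\det B$ and $\det C$ enter both sets: $M^-_N(B)/M^+_0(C)=\det B=q_0$ and $M^-_0(B)/M^+_N(C)=(\det C)^{-1}$, $q_N=\det C$; the remaining $2N$ functions $M^-_d(B)/M^+_{N-d}(C)$ ($0\le d\le N$) and $q_s$ ($1\le s\le N-1$) are algebraically independent over $\mathbb C$; 4. any algebraically independent (over $\mathbb C$) family of Casimir functions has at most $2N$ members, so the number of algebraically independent Casimir functions is exactly $2N$; 5. the generic corank of the bracket is exactly $2N$: for all $(B,C)$ in a nonempty Zariski open set, the $2N^2\times 2N^2$ matrix of the brackets of the coordinates $b_{i,j},c_{i,j}$ at $(B,C)$ has a kernel of dimension $2N$. -/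

import Mathlib

open scoped Kronecker

namespace BCSystem

/-! ### The trigonometric r-matrix and the Poisson tensor of the `(B, C)`-system -/

section Tensor

variable {N : ℕ} {R : Type*} [CommRing R]

/-- The classical trigonometric r-matrix
`r₁₂ = ∑ i, E_{i,i} ⊗ E_{i,i} + 2 ∑_{i > j} E_{i,j} ⊗ E_{j,i}`. -/
def rMatrix (N : ℕ) (R : Type*) [CommRing R] : Matrix (Fin N × Fin N) (Fin N × Fin N) R :=
  ∑ i : Fin N, Matrix.single i i (1 : R) ⊗ₖ Matrix.single i i (1 : R) +
    2 • ∑ i : Fin N, ∑ j ∈ Finset.univ.filter (fun j : Fin N => j < i),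
      Matrix.single i j (1 : R) ⊗ₖ Matrix.single j i (1 : R)

/-- The tensor `r₁₂ (X ⊗ Y) - (X ⊗ Y) r₁₂`. When it is the bracket `{X ⊗, Y}`, the bracket
`{X_{i,j}, Y_{k,l}}` of entries is its entry in row `(i, k)` and column `(j, l)`. -/
def rBracket (X Y : Matrix (Fin N) (Fin N) R) : Matrix (Fin N × Fin N) (Fin N × Fin N) R :=
  rMatrix N R * (X ⊗ₖ Y) - (X ⊗ₖ Y) * rMatrix N R

/-- Index set of the `2 N ^ 2` coordinates of a pair `(B, C)`: `Sum.inl (i, j)` stands for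
`b_{i,j}` and `Sum.inr (i, j)` for `c_{i,j}`. -/
abbrev Coord (N : ℕ) : Type := (Fin N × Fin N) ⊕ (Fin N × Fin N)

/-- The matrix of the brackets of the coordinate functions, at the pair `(B, C)`:
`{B ⊗, B} = r (B ⊗ B) - (B ⊗ B) r`, `{C ⊗, C} = r (C ⊗ C) - (C ⊗ C) r`,
`{C ⊗, B} = r (C ⊗ B) - (C ⊗ B) r`, and `{b, c} = - {c, b}`. -/
def poissonMatrix (B C : Matrix (Fin N) (Fin N) R) : Matrix (Coord N) (Coord N) R :=
  Matrix.of fun a b =>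
    match a, b with
    | Sum.inl (i, j), Sum.inl (k, l) => rBracket B B (i, k) (j, l)
    | Sum.inr (i, j), Sum.inr (k, l) => rBracket C C (i, k) (j, l)
    | Sum.inr (i, j), Sum.inl (k, l) => rBracket C B (i, k) (j, l)
    | Sum.inl (i, j), Sum.inr (k, l) => - rBracket C B (k, i) (l, j)

/-- The minor `M⁻_d(A)`: the `d × d` minor in the bottom-left corner of `A`. -/
def minorBottomLeft (A : Matrix (Fin N) (Fin N) R) (d : ℕ) (hd : d ≤ N) : R :=
  (A.submatrix (fun i : Fin d => (⟨N - d + i, by omega⟩ : Fin N))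
    (fun j : Fin d => (⟨j, by omega⟩ : Fin N))).det

/-- The minor `M⁺_d(A)`: the `d × d` minor in the upper-right corner of `A`. -/
def minorUpperRight (A : Matrix (Fin N) (Fin N) R) (d : ℕ) (hd : d ≤ N) : R :=
  (A.submatrix (fun i : Fin d => (⟨i, by omega⟩ : Fin N))
    (fun j : Fin d => (⟨N - d + j, by omega⟩ : Fin N))).det

/-- The coefficient of `λ ^ s` in `det (B + λ C)`. -/
noncomputable def pencilCoeff (B C : Matrix (Fin N) (Fin N) R) (s : ℕ) : R :=
  (B.map Polynomial.C + (Polynomial.X : Polynomial R) • C.map Polynomial.C).det.coeff s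

/-- The corank of a square matrix: the dimension of its kernel. -/
noncomputable def corank {ι k : Type*} [Fintype ι] [Field k] (M : Matrix ι ι k) : ℕ :=
  Module.finrank k (LinearMap.ker M.mulVecLin)

end Tensor

/-! ### The quotient rule -/

section QuotientRule

variable {A : Type*} [CommRing A] [Algebra ℂ A]
  {K : Type*} [Field K] [Algebra A K] [IsFractionRing A K]

/-- The derivative `(D n * d - n * D d) / d ^ 2` of the fraction `n / d`. -/
def quotientRule (D : Derivation ℂ A A) (n d : A) : K :=
  algebraMap A K (D n * d - n * D d) / algebraMap A K d ^ 2

/-- The quotient rule gives the same result for two representations of the same fraction. -/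
theorem quotientRule_congr (D : Derivation ℂ A A) (m e n d : A) (he : e ≠ 0) (hd : d ≠ 0)
    (h : algebraMap A K m / algebraMap A K e = algebraMap A K n / algebraMap A K d) :
    (quotientRule D m e : K) = quotientRule D n d := by
  have inj := IsFractionRing.injective A K
  have hd' : algebraMap A K d ≠ 0 := by
    rw [Ne, map_eq_zero_iff _ inj]; exact hd
  have he' : algebraMap A K e ≠ 0 := by
    rw [Ne, map_eq_zero_iff _ inj]; exact he
  have h1 : n * e = m * d := by
    apply inj
    rw [map_mul, map_mul]
    exact ((div_eq_div_iff he' hd').mp h).symm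
  have h2 := congrArg D h1
  rw [Derivation.leibniz, Derivation.leibniz] at h2
  simp only [smul_eq_mul] at h2
  unfold quotientRule
  rw [div_eq_div_iff (pow_ne_zero _ he') (pow_ne_zero _ hd'), ← map_pow, ← map_pow,
    ← map_mul, ← map_mul]
  congr 1
  linear_combination (-(d * e)) * h2 + (D d * e + d * D e) * h1

end QuotientRule

/-! ### Rational functions on `GL_N × GL_N` and their Poisson bracket -/

section RationalFunctions

variable {N : ℕ}

/-- Polynomial functions of the entries of `B` and `C`. -/
abbrev Poly (N : ℕ) : Type := MvPolynomial (Coord N) ℂ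

/-- The field of rational functions on `GL_N(ℂ) × GL_N(ℂ)`. -/
abbrev RatFn (N : ℕ) : Type := FractionRing (Poly N)

/-- The pair `(B, C)`, as a point of the affine space with coordinates `Coord N`. -/
def point (B C : Matrix (Fin N) (Fin N) ℂ) : Coord N → ℂ :=
  Sum.elim (fun p => B p.1 p.2) (fun p => C p.1 p.2)

/-- The coordinate functions. -/
noncomputable def coordFn (a : Coord N) : RatFn N := algebraMap (Poly N) (RatFn N) (MvPolynomial.X a)

/-- The matrix `B` of coordinate functions `b_{i,j}`. -/
noncomputable def genB (N : ℕ) : Matrix (Fin N) (Fin N) (RatFn N) :=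
  Matrix.of fun i j => coordFn (Sum.inl (i, j))

/-- The matrix `C` of coordinate functions `c_{i,j}`. -/
noncomputable def genC (N : ℕ) : Matrix (Fin N) (Fin N) (RatFn N) :=
  Matrix.of fun i j => coordFn (Sum.inr (i, j))

/-- The partial derivative of a rational function along the coordinate `a`, by the quotient rule
applied to its representation `num / den` in lowest terms. -/
noncomputable def partialDeriv (a : Coord N) (f : RatFn N) : RatFn N :=
  quotientRule (MvPolynomial.pderiv a) (IsFractionRing.num (Poly N) f)
    (IsFractionRing.den (Poly N) f)

/-- `partialDeriv` obeys the quotient rule on every representation of a fraction. -/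
theorem partialDeriv_div (a : Coord N) (n d : Poly N) (hd : d ≠ 0) :
    partialDeriv a (algebraMap (Poly N) (RatFn N) n / algebraMap (Poly N) (RatFn N) d) =
      quotientRule (MvPolynomial.pderiv a) n d := by
  refine quotientRule_congr (K := RatFn N) (MvPolynomial.pderiv a) _ _ n d
    (nonZeroDivisors.coe_ne_zero _) hd ?_
  rw [← IsFractionRing.mk'_eq_div, IsFractionRing.mk'_num_den]

/-- The Poisson bracket of two rational functions: the biderivation with the prescribed
brackets of the coordinate functions. -/
noncomputable def bracket (f g : RatFn N) : RatFn N :=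
  ∑ a : Coord N, ∑ b : Coord N,
    poissonMatrix (genB N) (genC N) a b * partialDeriv a f * partialDeriv b g

/-- A (rational) Casimir function: its bracket with every function vanishes. -/
def IsCasimir (f : RatFn N) : Prop := ∀ g : RatFn N, bracket f g = 0

/-- The functions `M⁻_d(B) / M⁺_{N-d}(C)`, for `0 ≤ d ≤ N`. -/
noncomputable def minorRatio (N : ℕ) (d : ℕ) (hd : d ≤ N) : RatFn N :=
  minorBottomLeft (genB N) d hd / minorUpperRight (genC N) (N - d) (Nat.sub_le N d)

/-- The functions `q_s`, with `det (B + λ C) = ∑ s, λ ^ s q_s`. -/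
noncomputable def pencilFn (N : ℕ) (s : ℕ) : RatFn N := pencilCoeff (genB N) (genC N) s

end RationalFunctions

end BCSystem

/-! The Casimir property comes from the triangular shape of the r-matrix. The Hamiltonian derivation
of a coordinate at position (i, j) changes the rows of a minor by multiples of row i and its columns
by multiples of column j. For a corner minor, the coefficients vanish whenever row i or column j
lies outside it, so the minor is an eigenvector (`derivation_minor`). In `minorRatio` the
eigenvalues of numerator and denominator coincide. For every constant x, B + xC transforms in the
same way, the row and column contributions to its determinant cancel, and the coefficients of the
pencil follow by varying x.

Independence is tested on pairs of antidiagonal matrices with entries x_j and y_j. There, up to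
signs, the ratios are x_1⋯x_d / (y_{d+1}⋯y_N) and det(B + λC) is ∏ (x_j + λ y_j). Successive ratios
give x_j y_j, the roots of the pencil give x_j / y_j, hence x_j² is known: all 2N variables are
algebraic over the field generated by the 2N restricted functions (`entries_mem_of_casimirs_mem`).
Counting transcendence degree makes these functions independent, and independence lifts from a
specialization (`AlgebraicIndependent.of_specialization`).

The corank is squeezed between two bounds. Differentials of Casimirs lie in the kernel of the
Poisson matrix and, in characteristic zero, independent functions have independent differentials, so
the generic corank is at least 2N (`card_le_corank`). At an antidiagonal point the Poisson matrix
splits into 2 × 2 blocks and its corank is at most 2N (`corank_antidiagonal_le`). Rank can only drop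
under specialization, so this bound holds generically; it also limits the number of independent
Casimirs. -/

namespace BCSystem

/-! ### Derivations acting on determinants and minors -/

section DerivationDet

variable {k R : Type*} [CommRing k] [CommRing R] [Algebra k R]

theorem derivation_prod {ι : Type*} [DecidableEq ι] (D : Derivation k R R) (s : Finset ι)
    (g : ι → R) : D (∏ i ∈ s, g i) = ∑ i ∈ s, (∏ j ∈ s.erase i, g j) * D (g i) := by
  induction s using Finset.induction_on with
  | empty => simp
  | insert a s ha ih =>
    rw [Finset.prod_insert ha, Derivation.leibniz, Finset.sum_insert ha, Finset.erase_insert ha, ih,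
      smul_eq_mul, smul_eq_mul, Finset.mul_sum, add_comm]
    congr 1
    refine Finset.sum_congr rfl fun i hi => ?_
    have hia : a ≠ i := fun h => ha (h ▸ hi)
    rw [Finset.erase_insert_of_ne hia,
      Finset.prod_insert (fun h => ha (Finset.mem_of_mem_erase h)), mul_assoc]

variable {n : Type*} [Fintype n] [DecidableEq n]

/-- Jacobi's formula for the derivative of a determinant. -/
theorem derivation_det (D : Derivation k R R) (M : Matrix n n R) :
    D M.det = (M.adjugate * M.map D).trace := by
  -- By Cramer's rule, each diagonal entry of the product is the determinant with one column
  -- differentiated.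
  have hcol : (M.adjugate * M.map D).trace = ∑ i, (M.updateCol i fun r => D (M r i)).det := by
    refine Finset.sum_congr rfl fun i _ => ?_
    rw [← Matrix.cramer_apply, Matrix.cramer_eq_adjugate_mulVec]
    rfl
  rw [hcol, Matrix.det_apply, map_sum]
  simp_rw [Matrix.det_apply]
  rw [Finset.sum_comm]
  refine Finset.sum_congr rfl fun σ _ => ?_
  rw [Units.smul_def, map_zsmul, derivation_prod, Finset.smul_sum]
  refine Finset.sum_congr rfl fun i _ => ?_
  rw [Units.smul_def, ← Finset.prod_erase_mul _ _ (Finset.mem_univ i)]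
  congr 2
  · refine Finset.prod_congr rfl fun j hj => ?_
    rw [Matrix.updateCol_ne (Finset.ne_of_mem_erase hj)]
  · rw [Matrix.updateCol_self]

/-- Infinitesimal form of the multiplicativity of det: in Jacobi's formula M and its adjugate meet,
after a cyclic shift in the U term, and leave the scalar det M. -/
theorem derivation_det_of_eq_mul_sub_mul (D : Derivation k R R) (M U V : Matrix n n R)
    (h : M.map D = U * M - M * V) : D M.det = (U.trace - V.trace) * M.det := by
  rw [derivation_det, h, mul_sub, Matrix.trace_sub, ← mul_assoc, ← mul_assoc, Matrix.trace_mul_comm,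
    ← mul_assoc, Matrix.mul_adjugate, Matrix.adjugate_mul, Matrix.smul_mul, Matrix.smul_mul,
    one_mul, one_mul, Matrix.trace_smul, Matrix.trace_smul, smul_eq_mul, smul_eq_mul]
  ring

/-- A derivation acting on the entries `A_{k,l}` by `u_k A_{i,l} - v_l A_{k,j}` multiplies by a
scalar every minor such that the row `i` is not needed outside of it, nor the column `j`. -/
theorem derivation_minor {m : Type*} [DecidableEq m]
    (D : Derivation k R R) (A : Matrix m m R) (e f : n → m)
    (he : Function.Injective e) (hf : Function.Injective f) (i j : m) (u v : m → R)
    (hA : ∀ a b, D (A (e a) (f b)) = u (e a) * A i (f b) - v (f b) * A (e a) j)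
    (hu : i ∉ Set.range e → ∀ a, u (e a) = 0) (hv : j ∉ Set.range f → ∀ b, v (f b) = 0)
    (κ μ : R) (hκ : ∀ a, e a = i → u i = κ) (hμ : ∀ b, f b = j → v j = μ)
    (hκ' : i ∉ Set.range e → κ = 0) (hμ' : j ∉ Set.range f → μ = 0) :
    D (A.submatrix e f).det = (κ - μ) * (A.submatrix e f).det := by
  -- U and V realize the row and column changes inside the minor: U has at most one nonzero column,
  -- at the position of i, and V at most one nonzero row, at the position of j. Hence their traces
  -- are κ and μ.
  set U : Matrix n n R := Matrix.of fun a b => if e b = i then u (e a) else 0 with hU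
  set V : Matrix n n R := Matrix.of fun a b => if f a = j then v (f b) else 0 with hV
  have tU : U.trace = κ := by
    by_cases hi : i ∈ Set.range e
    · obtain ⟨a, ha⟩ := hi
      rw [Matrix.trace, Finset.sum_eq_single a]
      · simp [hU, ha, hκ a ha]
      · intro b _ hb
        have : e b ≠ i := fun h => hb (he (h.trans ha.symm))
        simp [hU, this]
      · simp
    · rw [hκ' hi, Matrix.trace]
      refine Finset.sum_eq_zero fun a _ => ?_
      simp [hU, hu hi a]
  have tV : V.trace = μ := by
    by_cases hj : j ∈ Set.range f
    · obtain ⟨a, ha⟩ := hj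
      rw [Matrix.trace, Finset.sum_eq_single a]
      · simp [hV, ha, hμ a ha]
      · intro b _ hb
        have : f b ≠ j := fun h => hb (hf (h.trans ha.symm))
        simp [hV, this]
      · simp
    · rw [hμ' hj, Matrix.trace]
      refine Finset.sum_eq_zero fun a _ => ?_
      simp [hV, hv hj a]
  rw [← tU, ← tV]
  refine derivation_det_of_eq_mul_sub_mul D _ U V ?_
  ext a b
  rw [Matrix.map_apply, Matrix.submatrix_apply, hA, Matrix.sub_apply, Matrix.mul_apply,
    Matrix.mul_apply]
  congr 1
  · by_cases hi : i ∈ Set.range e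
    · obtain ⟨c, hc⟩ := hi
      rw [Finset.sum_eq_single c]
      · simp [hU, hc]
      · intro d _ hd
        have : e d ≠ i := fun h => hd (he (h.trans hc.symm))
        simp [hU, this]
      · simp
    · simp [hU, hu hi a]
  · by_cases hj : j ∈ Set.range f
    · obtain ⟨c, hc⟩ := hj
      rw [Finset.sum_eq_single c]
      · simp [hV, hc, mul_comm]
      · intro d _ hd
        have : f d ≠ j := fun h => hd (hf (h.trans hc.symm))
        simp [hV, this]
      · simp
    · simp [hV, hv hj b]

end DerivationDet

/-! ### The Jacobian criterion in characteristic zero -/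

section Jacobian

variable {k L V : Type*} [Field k] [CharZero k] [Field L] [Algebra k L]
  [AddCommGroup V] [Module L V] [Module k V] [IsScalarTower k L V]

/-- In characteristic zero, the differential of an element that is algebraic over `k(s)` is
a linear combination of the differentials of the elements of `s`. -/
theorem derivation_mem_span_of_isAlgebraic (d : Derivation k L V) (s : Set L) (x : L)
    (hx : IsAlgebraic (Algebra.adjoin k s) x) : d x ∈ Submodule.span L (d '' s) := by
  set W := Submodule.span L (d '' s) with hW
  -- Modulo the span W, the derivation kills s; its kernel E is a field containing k and s, so it
  -- suffices that a derivation vanishing on E kills every element algebraic over E.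
  let δ : Derivation k L (V ⧸ W) := W.mkQ.compDer d
  have hδ : ∀ y, δ y = 0 ↔ d y ∈ W := fun y => Submodule.Quotient.mk_eq_zero W
  let E : IntermediateField k L :=
    { carrier := {y | δ y = 0}
      mul_mem' := fun {a b} ha hb => by
        simp only [Set.mem_ofPred_eq] at *
        rw [Derivation.leibniz, ha, hb, smul_zero, smul_zero, add_zero]
      add_mem' := fun {a b} ha hb => by
        simp only [Set.mem_ofPred_eq] at *
        rw [map_add, ha, hb, add_zero]
      algebraMap_mem' := fun r => δ.map_algebraMap r
      inv_mem' := fun a ha => by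
        simp only [Set.mem_ofPred_eq] at *
        rw [Derivation.leibniz_inv, ha, smul_zero] }
  have hsE : Algebra.adjoin k s ≤ E.toSubalgebra :=
    Algebra.adjoin_le fun y hy => (hδ y).2 (Submodule.subset_span ⟨y, hy, rfl⟩)
  have hxE : IsAlgebraic E x := by
    obtain ⟨p, hp, hpx⟩ := hx
    refine ⟨p.map (Subalgebra.inclusion hsE).toRingHom, ?_, ?_⟩
    · rwa [Ne, Polynomial.map_eq_zero_iff (Subalgebra.inclusion_injective hsE)]
    · rw [Polynomial.aeval_def] at hpx ⊢
      rw [Polynomial.eval₂_map]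
      exact hpx
  have hint : IsIntegral E x := hxE.isIntegral
  -- Being E-linear, δ turns P(x) = 0, with P the minimal polynomial, into P'(x) δ(x) = 0, and P'(x)
  -- ≠ 0 by separability.
  let δE : Derivation E L (V ⧸ W) :=
    Derivation.mk'
      { toFun := δ
        map_add' := δ.map_add
        map_smul' := fun c y => by
          change δ ((c : L) * y) = (c : L) • δ y
          rw [Derivation.leibniz, show δ (c : L) = 0 from c.2, smul_zero, add_zero] }
      (fun a b => δ.leibniz a b)
  have h1 := δE.map_aeval (minpoly E x) x
  rw [minpoly.aeval, map_zero] at h1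
  have : CharZero E := charZero_of_injective_algebraMap (algebraMap k E).injective
  have hsep : (minpoly E x).Separable := (minpoly.irreducible hint).separable
  have hne := hsep.aeval_derivative_ne_zero (minpoly.aeval E x)
  rw [← hδ]
  exact (smul_eq_zero.1 h1.symm).resolve_left hne

/-- The Jacobian criterion in characteristic zero: if the differentials of a field of
transcendence degree `n` span an `n`-dimensional space, then algebraically independent elements
have linearly independent differentials. -/
theorem linearIndependent_derivation [Module.Finite L V]
    (d : Derivation k L V) (hd : Submodule.span L (Set.range d) = ⊤)
    (htr : Algebra.trdeg k L = Module.finrank L V)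
    {ι : Type*} (f : ι → L) (hf : AlgebraicIndependent k f) :
    LinearIndependent L fun i => d (f i) := by
  obtain ⟨s, hs, hbasis⟩ := exists_isTranscendenceBasis_superset hf.coe_range
  have hcard := hbasis.cardinalMk_eq_trdeg
  rw [htr] at hcard
  have : Finite s := Cardinal.mk_lt_aleph0_iff.1 (hcard ▸ Cardinal.natCast_lt_aleph0)
  have : Fintype s := Fintype.ofFinite s
  have halg : Algebra.IsAlgebraic (Algebra.adjoin k s) L := by
    have := hbasis.isAlgebraic
    rwa [Subtype.range_coe] at this
  -- The differentials of the transcendence basis s span V, and s has exactly dim V elements, so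
  -- they form a basis; those of f are among them.
  have hspan : (⊤ : Submodule L V) ≤ Submodule.span L (Set.range fun x : s => d x) := by
    rw [← hd, Submodule.span_le]
    rintro _ ⟨x, rfl⟩
    have := derivation_mem_span_of_isAlgebraic d s x (halg.isAlgebraic x)
    rwa [Set.image_eq_range] at this
  have hli := linearIndependent_of_top_le_span_of_card_eq_finrank hspan
    (by rw [Cardinal.mk_fintype] at hcard; exact_mod_cast hcard)
  exact hli.comp (fun i => ⟨f i, hs ⟨i, rfl⟩⟩)
    (fun i j h => hf.injective (congrArg Subtype.val h))

end Jacobian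

/-! ### Rank under specialization -/

section Rank

variable {k : Type*} [Field k] {ι : Type*} [Fintype ι]

theorem rank_add_corank (M : Matrix ι ι k) : M.rank + corank M = Fintype.card ι := by
  have := LinearMap.finrank_range_add_finrank_ker M.mulVecLin
  rwa [Module.finrank_fintype_fun_eq_card] at this

/-- A matrix of rank `r` is compressed to an invertible `r × r` matrix by suitable matrices. -/
theorem exists_mul_mul_eq_one (M : Matrix ι ι k) :
    ∃ (U : Matrix (Fin M.rank) ι k) (V : Matrix ι (Fin M.rank) k), U * M * V = 1 := by
  classical
  let f := M.mulVecLin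
  -- With a section s of f onto its range, a projection p onto that range and coordinates g on it,
  -- the composite g p f s g⁻¹ is the identity.
  obtain ⟨s, hs⟩ := f.rangeRestrict.exists_rightInverse_of_surjective f.range_rangeRestrict
  obtain ⟨p, hp⟩ := (LinearMap.range f).subtype.exists_leftInverse_of_injective
    (LinearMap.range f).ker_subtype
  let g : LinearMap.range f ≃ₗ[k] (Fin M.rank → k) :=
    (Module.finBasisOfFinrankEq k (LinearMap.range f) rfl).equivFun
  refine ⟨LinearMap.toMatrix' (g.toLinearMap ∘ₗ p),
    LinearMap.toMatrix' (s ∘ₗ g.symm.toLinearMap), ?_⟩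
  have hM : LinearMap.toMatrix' f = M := LinearMap.toMatrix'_toLin' M
  refine (congrArg (fun A => LinearMap.toMatrix' (g.toLinearMap ∘ₗ p) * A *
    LinearMap.toMatrix' (s ∘ₗ g.symm.toLinearMap)) hM.symm).trans ?_
  rw [← LinearMap.toMatrix'_comp, ← LinearMap.toMatrix'_comp, ← LinearMap.toMatrix'_id]
  congr 1
  ext1 x
  ext1
  have h1 : f (s (g.symm (LinearMap.single k (fun _ => k) x 1))) =
      (g.symm (LinearMap.single k (fun _ => k) x 1) : ι → k) :=
    congrArg Subtype.val (LinearMap.congr_fun hs (g.symm (LinearMap.single k (fun _ => k) x 1)))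
  have h2 := LinearMap.congr_fun hp (g.symm (LinearMap.single k (fun _ => k) x 1))
  simp only [LinearMap.comp_apply, LinearEquiv.coe_coe, LinearMap.id_apply] at h2 ⊢
  rw [h1]
  exact (congrArg g h2).trans (g.apply_symm_apply _)

theorem le_rank_of_det_ne_zero {r : ℕ} (M : Matrix ι ι k) (U : Matrix (Fin r) ι k)
    (V : Matrix ι (Fin r) k) (h : (U * M * V).det ≠ 0) : r ≤ M.rank := by
  have h1 : (U * M * V).rank = r := by
    rw [Matrix.rank_of_isUnit _ ((Matrix.isUnit_iff_isUnit_det _).2 h.isUnit), Fintype.card_fin]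
  calc r = (U * M * V).rank := h1.symm
    _ ≤ (U * M).rank := Matrix.rank_mul_le_left _ _
    _ ≤ M.rank := Matrix.rank_mul_le_right _ _

/-- The rank of a matrix of polynomials is at least the rank of its value at a point, at all
points outside a hypersurface and over every field containing the polynomials. -/
theorem exists_ne_zero_forall_rank_le {σ : Type*} (M : Matrix ι ι (MvPolynomial σ k)) (x : σ → k) :
    ∃ F : MvPolynomial σ k, F ≠ 0 ∧ ∀ {K : Type*} [Field K] (φ : MvPolynomial σ k →+* K),
      φ F ≠ 0 → (M.map (MvPolynomial.eval x)).rank ≤ (M.map φ).rank := by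
  obtain ⟨U, V, h⟩ := exists_mul_mul_eq_one (M.map (MvPolynomial.eval x))
  let U' : Matrix (Fin _) ι (MvPolynomial σ k) := U.map MvPolynomial.C
  let V' : Matrix ι (Fin _) (MvPolynomial σ k) := V.map MvPolynomial.C
  refine ⟨(U' * M * V').det, ?_, ?_⟩
  · intro h0
    have h1 : MvPolynomial.eval x (U' * M * V').det = 1 := by
      have hU : U'.map (MvPolynomial.eval x) = U := by ext i j; simp [U']
      have hV : V'.map (MvPolynomial.eval x) = V := by ext i j; simp [V']
      rw [RingHom.map_det, RingHom.mapMatrix_apply, Matrix.map_mul, Matrix.map_mul, hU, hV, h,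
        Matrix.det_one]
    rw [h0, map_zero] at h1
    exact zero_ne_one h1
  · intro K _ φ hφ
    rw [RingHom.map_det, RingHom.mapMatrix_apply, Matrix.map_mul, Matrix.map_mul] at hφ
    exact le_rank_of_det_ne_zero _ _ _ hφ

end Rank

/-! ### Lifting algebraic independence from a specialization -/

section Specialization

/-- Fractions are algebraically independent if their images under a specialization which does
not annihilate the denominators are. -/
theorem AlgebraicIndependent.of_specialization {k A K L ι : Type*} [Field k] [CommRing A]
    [IsDomain A] [Algebra k A] [Field K] [Algebra A K] [IsFractionRing A K] [Algebra k K]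
    [IsScalarTower k A K] [Field L] [Algebra k L] (φ : A →ₐ[k] L) (n d : ι → A)
    (hd : ∀ i, φ (d i) ≠ 0)
    (h : AlgebraicIndependent k fun i => φ (n i) / φ (d i)) :
    AlgebraicIndependent k fun i => algebraMap A K (n i) / algebraMap A K (d i) := by
  -- Localizing at the elements that φ does not kill gives a ring S that maps to L and embeds in K.
  -- Independence pulls back from L to S and is carried into K by the embedding.
  let M : Submonoid A := (nonZeroDivisors L).comap φ
  have hM : M ≤ nonZeroDivisors A := fun a ha => by
    rw [mem_nonZeroDivisors_iff_ne_zero]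
    rintro rfl
    have := nonZeroDivisors.ne_zero (show φ 0 ∈ nonZeroDivisors L from ha)
    exact this (map_zero φ)
  let S := Localization M
  have hφ : ∀ y : M, IsUnit (φ y) := fun y => (nonZeroDivisors.ne_zero y.2).isUnit
  have hK : ∀ y : M, IsUnit (algebraMap A K y) := fun y =>
    (IsFractionRing.to_map_ne_zero_of_mem_nonZeroDivisors (K := K) (hM y.2)).isUnit
  let ψ : S →ₐ[k] L := IsLocalization.liftAlgHom (M := M) (f := φ) hφ
  let χ : S →ₐ[k] K := IsLocalization.liftAlgHom (M := M) (f := IsScalarTower.toAlgHom k A K) hK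
  have hχ : Function.Injective χ := by
    refine (IsLocalization.lift_injective_iff (M := M) (S := S) (g := algebraMap A K) hK).2 ?_
    intro a b
    rw [(IsLocalization.injective S hM).eq_iff, (IsFractionRing.injective A K).eq_iff]
  let y : ι → M := fun i => ⟨d i, mem_nonZeroDivisors_of_ne_zero (hd i)⟩
  have hs : AlgebraicIndependent k fun i => (IsLocalization.mk' S (n i) (y i) : S) := by
    refine AlgebraicIndependent.of_comp ψ ?_
    convert! h using 1
    funext i
    rw [eq_div_iff (hd i), Function.comp_apply]
    change ψ _ * φ (y i) = _
    have : ψ (algebraMap A S (y i)) = φ (y i) := IsLocalization.lift_eq hφ _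
    rw [← this, ← map_mul, IsLocalization.mk'_spec]
    exact IsLocalization.lift_eq hφ _
  have := hs.map' hχ
  convert! this using 1
  funext i
  have hne : algebraMap A K (d i) ≠ 0 := (hK (y i)).ne_zero
  symm
  rw [eq_div_iff hne, Function.comp_apply]
  change χ _ * algebraMap A K (y i) = _
  have : χ (algebraMap A S (y i)) = algebraMap A K (y i) := IsLocalization.lift_eq hK _
  rw [← this, ← map_mul, IsLocalization.mk'_spec]
  exact IsLocalization.lift_eq hK _

end Specialization

/-! ### Entries of the r-matrix and of the Poisson tensor -/

section Entries

variable {N : ℕ} {R : Type*} [CommRing R]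

/-- The coefficient `1 + sgn (i - k)` of `E_{i,k} ⊗ E_{k,i}` in the r-matrix. -/
def rCoeff (R : Type*) [CommRing R] (i k : Fin N) : R :=
  if i = k then 1 else if k < i then 2 else 0

theorem rCoeff_self (i : Fin N) : rCoeff R i i = 1 := if_pos rfl

theorem rCoeff_of_lt {i k : Fin N} (h : k < i) : rCoeff R i k = 2 := by
  rw [rCoeff, if_neg h.ne', if_pos h]

theorem rCoeff_of_gt {i k : Fin N} (h : i < k) : rCoeff R i k = 0 := by
  rw [rCoeff, if_neg h.ne, if_neg h.asymm]

theorem rCoeff_add_rCoeff (i k : Fin N) : rCoeff R i k + rCoeff R k i = 2 := by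
  rcases lt_trichotomy i k with h | h | h
  · rw [rCoeff_of_gt h, rCoeff_of_lt h, zero_add]
  · rw [h, rCoeff_self, one_add_one_eq_two]
  · rw [rCoeff_of_gt h, rCoeff_of_lt h, add_zero]

theorem rCoeff_eq_two_sub (i k : Fin N) : rCoeff R i k = 2 - rCoeff R k i :=
  eq_sub_of_add_eq (rCoeff_add_rCoeff i k)

theorem map_rCoeff {S : Type*} [CommRing S] (φ : R →+* S) (i k : Fin N) :
    φ (rCoeff R i k) = rCoeff S i k := by
  simp only [rCoeff, apply_ite φ, map_one, map_zero, map_ofNat]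

theorem rMatrix_apply (i k p q : Fin N) :
    rMatrix N R (i, k) (p, q) = if p = k ∧ q = i then rCoeff R i k else 0 := by
  have h1 : ∀ a b c d : Fin N, (Matrix.single a b (1 : R) ⊗ₖ Matrix.single c d (1 : R))
      (i, k) (p, q) = if a = i ∧ b = p ∧ c = k ∧ d = q then 1 else 0 := by
    intro a b c d
    rw [Matrix.kroneckerMap_apply, Matrix.single_apply, Matrix.single_apply, ite_zero_mul_ite_zero,
      one_mul]
    exact if_congr and_assoc rfl rfl
  rw [rMatrix, Matrix.add_apply, Matrix.sum_apply, Matrix.smul_apply, Matrix.sum_apply]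
  simp_rw [Matrix.sum_apply, h1]
  rw [Finset.sum_eq_single i (fun b _ hb => if_neg fun h => hb h.1) (by simp),
    Finset.sum_eq_single i
      (fun b _ hb => Finset.sum_eq_zero fun c _ => if_neg fun h => hb h.1) (by simp),
    Finset.sum_filter, Finset.sum_eq_single k
      (fun b _ hb => ite_eq_right_iff.2 fun _ => if_neg fun h => hb h.2.2.1) (by simp)]
  rcases lt_trichotomy i k with h | h | h
  · rw [rCoeff_of_gt h, if_neg h.asymm, if_neg (fun h' => h.ne h'.2.2.1)]
    simp only [smul_zero, add_zero, ite_self]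
  · subst h
    rw [rCoeff_self, if_neg (lt_irrefl _), smul_zero, add_zero]
    simp only [true_and, eq_comm]
  · rw [rCoeff_of_lt h, if_pos h, if_neg (fun h' => (ne_of_gt h) h'.2.2.1), zero_add, nsmul_eq_mul]
    simp only [true_and, eq_comm (a := p), eq_comm (a := q)]
    simp

/-- Row (i, k) of r is supported in column (k, i) and column (j, l) in row (l, j), so each matrix
product collapses to one term. -/
theorem rBracket_apply (X Y : Matrix (Fin N) (Fin N) R) (i j k l : Fin N) :
    rBracket X Y (i, k) (j, l) =
      rCoeff R i k * X k j * Y i l - rCoeff R l j * X i l * Y k j := by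
  rw [rBracket, Matrix.sub_apply, Matrix.mul_apply, Matrix.mul_apply,
    Finset.sum_eq_single (k, i), Finset.sum_eq_single (l, j)]
  · rw [rMatrix_apply, rMatrix_apply, if_pos ⟨rfl, rfl⟩, if_pos ⟨rfl, rfl⟩,
      Matrix.kroneckerMap_apply, Matrix.kroneckerMap_apply]
    ring
  · rintro ⟨p, q⟩ _ h
    rw [rMatrix_apply, if_neg, mul_zero]
    rintro ⟨rfl, rfl⟩
    exact h rfl
  · simp
  · rintro ⟨p, q⟩ _ h
    rw [rMatrix_apply, if_neg, zero_mul]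
    rintro ⟨rfl, rfl⟩
    exact h rfl
  · simp

variable (B C : Matrix (Fin N) (Fin N) R) (i j k l : Fin N)

theorem poissonMatrix_inr_inl : poissonMatrix B C (Sum.inr (i, j)) (Sum.inl (k, l)) =
    rCoeff R i k * C k j * B i l - rCoeff R l j * C i l * B k j := rBracket_apply _ _ _ _ _ _

theorem poissonMatrix_inr_inr : poissonMatrix B C (Sum.inr (i, j)) (Sum.inr (k, l)) =
    rCoeff R i k * C k j * C i l - rCoeff R l j * C i l * C k j := rBracket_apply _ _ _ _ _ _

theorem poissonMatrix_inl_inl : poissonMatrix B C (Sum.inl (i, j)) (Sum.inl (k, l)) =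
    rCoeff R i k * B k j * B i l - rCoeff R l j * B i l * B k j := rBracket_apply _ _ _ _ _ _

theorem poissonMatrix_inl_inr : poissonMatrix B C (Sum.inl (i, j)) (Sum.inr (k, l)) =
    -(rCoeff R k i * C i l * B k j - rCoeff R j l * C k j * B i l) :=
  congrArg Neg.neg (rBracket_apply _ _ _ _ _ _)

/-- The symmetric part of r is the permutation operator, which commutes with X ⊗ X; in entries, the
constants 2 from `rCoeff_eq_two_sub` cancel. -/
theorem poissonMatrix_antisymm (a b : Coord N) :
    poissonMatrix B C a b = -poissonMatrix B C b a := by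
  rcases a with ⟨i, j⟩ | ⟨i, j⟩ <;> rcases b with ⟨k, l⟩ | ⟨k, l⟩
  · rw [poissonMatrix_inl_inl, poissonMatrix_inl_inl, rCoeff_eq_two_sub i k, rCoeff_eq_two_sub j l]
    ring
  · rw [poissonMatrix_inl_inr, poissonMatrix_inr_inl]
  · rw [poissonMatrix_inl_inr, poissonMatrix_inr_inl, neg_neg]
  · rw [poissonMatrix_inr_inr, poissonMatrix_inr_inr, rCoeff_eq_two_sub i k, rCoeff_eq_two_sub j l]
    ring

theorem poissonMatrix_map {S : Type*} [CommRing S] (φ : R →+* S) :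
    (poissonMatrix B C).map φ = poissonMatrix (B.map φ) (C.map φ) := by
  ext a b
  rw [Matrix.map_apply]
  rcases a with ⟨i, j⟩ | ⟨i, j⟩ <;> rcases b with ⟨k, l⟩ | ⟨k, l⟩ <;>
    simp only [poissonMatrix_inl_inl, poissonMatrix_inl_inr, poissonMatrix_inr_inl,
      poissonMatrix_inr_inr, map_sub, map_neg, map_mul, map_rCoeff, Matrix.map_apply]

end Entries

/-! ### Hamiltonian derivations and differentials of Casimirs -/

section Derivations

variable {N : ℕ}

theorem partialDeriv_algebraMap (a : Coord N) (p : Poly N) :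
    partialDeriv a (algebraMap (Poly N) (RatFn N) p) =
      algebraMap (Poly N) (RatFn N) (MvPolynomial.pderiv a p) := by
  have h := partialDeriv_div a p 1 one_ne_zero
  rw [map_one, div_one] at h
  rw [h, quotientRule]
  simp

theorem exists_eq_div (f : RatFn N) : ∃ n d : Poly N, d ≠ 0 ∧
    f = algebraMap (Poly N) (RatFn N) n / algebraMap (Poly N) (RatFn N) d := by
  obtain ⟨n, d, hd, h⟩ := IsFractionRing.div_surjective (A := Poly N) f
  exact ⟨n, d, nonZeroDivisors.ne_zero hd, h.symm⟩

theorem partialDeriv_add (a : Coord N) (f g : RatFn N) :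
    partialDeriv a (f + g) = partialDeriv a f + partialDeriv a g := by
  obtain ⟨n, d, hd, rfl⟩ := exists_eq_div f
  obtain ⟨m, e, he, rfl⟩ := exists_eq_div g
  have hd' : algebraMap (Poly N) (RatFn N) d ≠ 0 := by simpa using hd
  have he' : algebraMap (Poly N) (RatFn N) e ≠ 0 := by simpa using he
  have h : algebraMap (Poly N) (RatFn N) n / algebraMap (Poly N) (RatFn N) d +
      algebraMap (Poly N) (RatFn N) m / algebraMap (Poly N) (RatFn N) e =
      algebraMap (Poly N) (RatFn N) (n * e + d * m) /
        algebraMap (Poly N) (RatFn N) (d * e) := by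
    rw [div_add_div _ _ hd' he']
    simp only [map_mul, map_add]
  rw [h, partialDeriv_div a _ _ (mul_ne_zero hd he), partialDeriv_div a _ _ hd,
    partialDeriv_div a _ _ he]
  simp only [quotientRule, Derivation.leibniz, map_add, map_mul, map_sub, smul_eq_mul]
  generalize algebraMap (Poly N) (RatFn N) d = d' at *
  generalize algebraMap (Poly N) (RatFn N) e = e' at *
  field_simp
  ring

theorem partialDeriv_smul (a : Coord N) (c : ℂ) (f : RatFn N) :
    partialDeriv a (c • f) = c • partialDeriv a f := by
  obtain ⟨n, d, hd, rfl⟩ := exists_eq_div f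
  have hs : ∀ p : Poly N, algebraMap (Poly N) (RatFn N) (c • p) =
      c • algebraMap (Poly N) (RatFn N) p := fun p =>
    map_smul (IsScalarTower.toAlgHom ℂ (Poly N) (RatFn N)) c p
  rw [← smul_div_assoc, ← hs, partialDeriv_div a _ _ hd, partialDeriv_div a _ _ hd]
  simp only [quotientRule]
  rw [Derivation.map_smul, smul_mul_assoc, smul_mul_assoc, ← smul_sub, hs, smul_div_assoc]

theorem partialDeriv_mul (a : Coord N) (f g : RatFn N) :
    partialDeriv a (f * g) = f * partialDeriv a g + g * partialDeriv a f := by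
  obtain ⟨n, d, hd, rfl⟩ := exists_eq_div f
  obtain ⟨m, e, he, rfl⟩ := exists_eq_div g
  have hd' : algebraMap (Poly N) (RatFn N) d ≠ 0 := by simpa using hd
  have he' : algebraMap (Poly N) (RatFn N) e ≠ 0 := by simpa using he
  have h : algebraMap (Poly N) (RatFn N) n / algebraMap (Poly N) (RatFn N) d *
      (algebraMap (Poly N) (RatFn N) m / algebraMap (Poly N) (RatFn N) e) =
      algebraMap (Poly N) (RatFn N) (n * m) / algebraMap (Poly N) (RatFn N) (d * e) := by
    rw [div_mul_div_comm, map_mul, map_mul]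
  rw [h, partialDeriv_div a _ _ (mul_ne_zero hd he), partialDeriv_div a _ _ hd,
    partialDeriv_div a _ _ he]
  simp only [quotientRule, Derivation.leibniz, map_add, map_mul, map_sub, smul_eq_mul]
  generalize algebraMap (Poly N) (RatFn N) d = d' at *
  generalize algebraMap (Poly N) (RatFn N) e = e' at *
  field_simp
  ring

/-- The partial derivative as a derivation of the field of rational functions. -/
noncomputable def partialDerivation (a : Coord N) : Derivation ℂ (RatFn N) (RatFn N) :=
  Derivation.mk'
    { toFun := partialDeriv a
      map_add' := partialDeriv_add a
      map_smul' := partialDeriv_smul a }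
    (partialDeriv_mul a)

theorem partialDeriv_coordFn (a b : Coord N) :
    partialDeriv a (coordFn b) = if a = b then 1 else 0 := by
  classical
  rw [coordFn, partialDeriv_algebraMap, MvPolynomial.pderiv_X]
  by_cases h : a = b
  · subst h; simp
  · simp [h]

/-- The differential of a rational function, as the vector of its partial derivatives. -/
noncomputable def differential (N : ℕ) : Derivation ℂ (RatFn N) (Coord N → RatFn N) :=
  Derivation.mk'
    { toFun := fun f a => partialDerivation a f
      map_add' := fun _ _ => funext fun _ => map_add _ _ _
      map_smul' := fun _ _ => funext fun _ => Derivation.map_smul _ _ _ }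
    (fun f g => funext fun a => (partialDerivation a).leibniz f g)

theorem differential_apply (f : RatFn N) (a : Coord N) :
    differential N f a = partialDeriv a f := rfl

/-- The Hamiltonian derivation `{x_a, ·}` of a coordinate function `x_a`. -/
noncomputable def hamiltonian (a : Coord N) : Derivation ℂ (RatFn N) (RatFn N) :=
  ∑ b : Coord N, poissonMatrix (genB N) (genC N) a b • partialDerivation b

theorem hamiltonian_apply (a : Coord N) (f : RatFn N) :
    hamiltonian a f = ∑ b : Coord N, poissonMatrix (genB N) (genC N) a b * partialDeriv b f := by
  rw [hamiltonian, ← Derivation.coeFnAddMonoidHom_apply, map_sum, Finset.sum_apply]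
  rfl

theorem hamiltonian_coordFn (a b : Coord N) :
    hamiltonian a (coordFn b) = poissonMatrix (genB N) (genC N) a b := by
  rw [hamiltonian_apply, Finset.sum_eq_single b]
  · rw [partialDeriv_coordFn, if_pos rfl, mul_one]
  · intro c _ hc
    rw [partialDeriv_coordFn, if_neg hc, mul_zero]
  · simp

theorem bracket_eq (f g : RatFn N) :
    bracket f g = -∑ b : Coord N, hamiltonian b f * partialDeriv b g := by
  rw [bracket, Finset.sum_comm, ← Finset.sum_neg_distrib]
  refine Finset.sum_congr rfl fun b _ => ?_
  rw [hamiltonian_apply, Finset.sum_mul, ← Finset.sum_neg_distrib]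
  refine Finset.sum_congr rfl fun a _ => ?_
  rw [poissonMatrix_antisymm _ _ a b]
  ring

/-- The bracket is a derivation in its second argument, so brackets with the coordinates determine
it. -/
theorem isCasimir_iff (f : RatFn N) : IsCasimir f ↔ ∀ a, hamiltonian a f = 0 := by
  constructor
  · intro h a
    have h1 := h (coordFn a)
    rw [bracket_eq, neg_eq_zero, Finset.sum_eq_single a] at h1
    · rwa [partialDeriv_coordFn, if_pos rfl, mul_one] at h1
    · intro c _ hc
      rw [partialDeriv_coordFn, if_neg hc, mul_zero]
    · simp
  · intro h g
    rw [bracket_eq]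
    simp [h]

theorem IsCasimir.mulVec_differential {f : RatFn N} (h : IsCasimir f) :
    (poissonMatrix (genB N) (genC N)).mulVec (differential N f) = 0 := by
  funext a
  rw [Pi.zero_apply, ← (isCasimir_iff f).1 h a, hamiltonian_apply]
  rfl

theorem span_range_differential : Submodule.span (RatFn N) (Set.range (differential N)) = ⊤ := by
  classical
  rw [eq_top_iff, ← (Pi.basisFun (RatFn N) (Coord N)).span_eq]
  refine Submodule.span_mono ?_
  rintro _ ⟨a, rfl⟩
  refine ⟨coordFn a, funext fun b => ?_⟩
  rw [differential_apply, partialDeriv_coordFn, Pi.basisFun_apply, Pi.single_apply]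

theorem trdeg_fractionRing_mvPolynomial (σ : Type) [Fintype σ] :
    Algebra.trdeg ℂ (FractionRing (MvPolynomial σ ℂ)) = Fintype.card σ := by
  have hX : IsTranscendenceBasis ℂ (MvPolynomial.X : σ → MvPolynomial σ ℂ) := .mvPolynomial σ ℂ
  have : Algebra.IsAlgebraic (MvPolynomial σ ℂ) (FractionRing (MvPolynomial σ ℂ)) :=
    IsLocalization.isAlgebraic _ (nonZeroDivisors (MvPolynomial σ ℂ))
  have hL := hX.algebraMap_comp (A := FractionRing (MvPolynomial σ ℂ))
  rw [← hL.cardinalMk_eq_trdeg, Cardinal.mk_fintype]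

/-- Differentials of algebraically independent rational functions are linearly independent. -/
theorem linearIndependent_differential {ι : Type*} {f : ι → RatFn N}
    (hf : AlgebraicIndependent ℂ f) : LinearIndependent (RatFn N) fun i => differential N (f i) :=
  linearIndependent_derivation (differential N) span_range_differential
    (by rw [trdeg_fractionRing_mvPolynomial, Module.finrank_fintype_fun_eq_card]) f hf

theorem card_le_corank {ι : Type*} [Fintype ι] {f : ι → RatFn N} (hc : ∀ i, IsCasimir (f i))
    (hf : AlgebraicIndependent ℂ f) :
    Fintype.card ι ≤ corank (poissonMatrix (genB N) (genC N)) := by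
  have hli := linearIndependent_differential hf
  let K := LinearMap.ker (poissonMatrix (genB N) (genC N)).mulVecLin
  let v : ι → K := fun i => ⟨differential N (f i), (hc i).mulVec_differential⟩
  have hv : LinearIndependent (RatFn N) v := LinearIndependent.of_comp K.subtype hli
  exact hv.fintype_card_le_finrank

end Derivations

/-! ### Corner minors and pencil coefficients under a Hamiltonian derivation -/

section Minors

variable {N : ℕ} {k R : Type*} [CommRing k] [CommRing R] [Algebra k R] (D : Derivation k R R)
  (A X : Matrix (Fin N) (Fin N) R) (i j : Fin N)

/-- The corner position is essential: a row i outside the minor lies above all its rows, and a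
column j outside lies to the right of all its columns, so the relevant `rCoeff` vanishes. X stands
for whichever of B and C supplies the Hamiltonian. -/
theorem derivation_minorBottomLeft
    (hA : ∀ a b, D (A a b) =
      rCoeff R i a * X a j * A i b - rCoeff R b j * X i b * A a j) (d : ℕ) (hd : d ≤ N) :
    D (minorBottomLeft A d hd) =
      ((if N - d ≤ i then X i j else 0) - (if (j : ℕ) < d then X i j else 0)) *
        minorBottomLeft A d hd := by
  have hi : i ∉ Set.range (fun a : Fin d => (⟨N - d + a, by omega⟩ : Fin N)) → (i : ℕ) < N - d := by
    intro h
    by_contra h'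
    exact h ⟨⟨i - (N - d), by omega⟩, Fin.ext (by simp only; omega)⟩
  have hj : j ∉ Set.range (fun b : Fin d => (⟨b, by omega⟩ : Fin N)) → d ≤ (j : ℕ) := by
    intro h
    by_contra h'
    exact h ⟨⟨j, by omega⟩, rfl⟩
  refine derivation_minor D A _ _ (fun a b h => Fin.ext (by simpa using h))
    (fun a b h => Fin.ext (by simpa using h)) i j (fun a => rCoeff R i a * X a j)
    (fun b => rCoeff R b j * X i b) (fun a b => hA _ _) ?_ ?_ _ _ ?_ ?_ ?_ ?_
  · intro h a
    have := hi h
    exact mul_eq_zero_of_left (rCoeff_of_gt (Fin.lt_def.2 (by simp only; omega))) _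
  · intro h b
    have := hj h
    exact mul_eq_zero_of_left (rCoeff_of_gt (Fin.lt_def.2 (by simp only; omega))) _
  · rintro a rfl
    rw [rCoeff_self, one_mul, if_pos (by simp only; omega)]
  · rintro b rfl
    rw [rCoeff_self, one_mul, if_pos (by simp only; omega)]
  · intro h
    rw [if_neg (not_le.2 (hi h))]
  · intro h
    rw [if_neg (not_lt.2 (hj h))]

theorem derivation_minorUpperRight
    (hA : ∀ a b, D (A a b) =
      rCoeff R j b * X i b * A a j - rCoeff R a i * X a j * A i b) (d : ℕ) (hd : d ≤ N) :
    D (minorUpperRight A d hd) =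
      ((if N - d ≤ j then X i j else 0) - (if (i : ℕ) < d then X i j else 0)) *
        minorUpperRight A d hd := by
  have hj : j ∉ Set.range (fun a : Fin d => (⟨N - d + a, by omega⟩ : Fin N)) → (j : ℕ) < N - d := by
    intro h
    by_contra h'
    exact h ⟨⟨j - (N - d), by omega⟩, Fin.ext (by simp only; omega)⟩
  have hi : i ∉ Set.range (fun b : Fin d => (⟨b, by omega⟩ : Fin N)) → d ≤ (i : ℕ) := by
    intro h
    by_contra h'
    exact h ⟨⟨i, by omega⟩, rfl⟩
  rw [← neg_sub_neg]
  refine derivation_minor D A _ _ (fun a b h => Fin.ext (by simpa using h))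
    (fun a b h => Fin.ext (by simpa using h)) i j (fun a => -(rCoeff R a i * X a j))
    (fun b => -(rCoeff R j b * X i b)) (fun a b => by rw [hA]; ring) ?_ ?_ _ _ ?_ ?_ ?_ ?_
  · intro h a
    have := hi h
    exact neg_eq_zero.2
      (mul_eq_zero_of_left (rCoeff_of_gt (Fin.lt_def.2 (by simp only; omega))) _)
  · intro h b
    have := hj h
    exact neg_eq_zero.2
      (mul_eq_zero_of_left (rCoeff_of_gt (Fin.lt_def.2 (by simp only; omega))) _)
  · rintro a rfl
    rw [rCoeff_self, one_mul, if_pos (by simp only; omega)]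
  · rintro b rfl
    rw [rCoeff_self, one_mul, if_pos (by simp only; omega)]
  · intro h
    rw [if_neg (not_lt.2 (hi h)), neg_zero]
  · intro h
    rw [if_neg (not_le.2 (hj h)), neg_zero]

theorem derivation_det_eq_zero (u v : Fin N → R)
    (hA : ∀ a b, D (A a b) = u a * A i b - v b * A a j) (huv : u i = v j) : D A.det = 0 := by
  have h := derivation_minor D A id id Function.injective_id Function.injective_id i j u v hA
    (fun h => absurd ⟨i, rfl⟩ h) (fun h => absurd ⟨j, rfl⟩ h) (u i) (v j) (fun _ _ => rfl)
    (fun _ _ => rfl) (fun h => absurd ⟨i, rfl⟩ h) (fun h => absurd ⟨j, rfl⟩ h)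
  rwa [huv, sub_self, zero_mul, Matrix.submatrix_id_id] at h

theorem eval_det_pencil (B C : Matrix (Fin N) (Fin N) R) (x : R) :
    (B.map Polynomial.C + (Polynomial.X : Polynomial R) • C.map Polynomial.C).det.eval x =
      (B + x • C).det := by
  rw [← Polynomial.coe_evalRingHom, RingHom.map_det]
  congr 1
  ext a b
  simp only [Polynomial.coe_evalRingHom, RingHom.mapMatrix_apply, Matrix.map_apply,
    Matrix.add_apply, Matrix.smul_apply, smul_eq_mul, Polynomial.eval_add, Polynomial.eval_mul,
    Polynomial.eval_X, Polynomial.eval_C]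

theorem pencilCoeff_map {S : Type*} [CommRing S] (φ : R →+* S) (B C : Matrix (Fin N) (Fin N) R)
    (s : ℕ) : φ (pencilCoeff B C s) = pencilCoeff (B.map φ) (C.map φ) s := by
  rw [pencilCoeff, pencilCoeff, ← Polynomial.coeff_map, ← Polynomial.coe_mapRingHom,
    RingHom.map_det]
  congr 2
  ext a b
  simp

theorem minorBottomLeft_map {S : Type*} [CommRing S] (φ : R →+* S) (d : ℕ) (hd : d ≤ N) :
    φ (minorBottomLeft A d hd) = minorBottomLeft (A.map φ) d hd := by
  rw [minorBottomLeft, RingHom.map_det]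
  rfl

theorem minorUpperRight_map {S : Type*} [CommRing S] (φ : R →+* S) (d : ℕ) (hd : d ≤ N) :
    φ (minorUpperRight A d hd) = minorUpperRight (A.map φ) d hd := by
  rw [minorUpperRight, RingHom.map_det]
  rfl

theorem minorBottomLeft_self : minorBottomLeft A N le_rfl = A.det := by
  rw [minorBottomLeft]
  congr 1
  ext a b
  rw [Matrix.submatrix_apply]
  congr 1
  exact Fin.ext (by simp)

theorem minorUpperRight_self : minorUpperRight A N le_rfl = A.det := by
  rw [minorUpperRight]
  congr 1
  ext a b
  rw [Matrix.submatrix_apply]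
  congr 1
  exact Fin.ext (by simp)

theorem minorBottomLeft_zero (h : 0 ≤ N) : minorBottomLeft A 0 h = 1 := Matrix.det_isEmpty

theorem minorUpperRight_sub_self (h : N - N ≤ N) : minorUpperRight A (N - N) h = 1 := by
  have : IsEmpty (Fin (N - N)) := ⟨fun a => by have := a.2; omega⟩
  exact Matrix.det_isEmpty

theorem pencilCoeff_zero (B C : Matrix (Fin N) (Fin N) R) : pencilCoeff B C 0 = B.det := by
  rw [pencilCoeff, add_comm, Polynomial.coeff_det_X_add_C_zero]

theorem pencilCoeff_self (B C : Matrix (Fin N) (Fin N) R) : pencilCoeff B C N = C.det := by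
  have := Polynomial.coeff_det_X_add_C_card C B
  rwa [Fintype.card_fin, add_comm] at this

end Minors

/-- If a derivation over an infinite field kills the values of a polynomial at all constants, then
it kills its coefficients. -/
theorem derivation_coeff_eq_zero {k K : Type*} [Field k] [Infinite k] [Field K] [Algebra k K]
    (D : Derivation k K K) (p : Polynomial K) (h : ∀ x : k, D (p.eval (algebraMap k K x)) = 0)
    (s : ℕ) : D (p.coeff s) = 0 := by
  -- q is p with D applied to its coefficients. Since D kills constants, D (p(x)) = q(x) for x in k,
  -- so q has infinitely many roots.
  set q : Polynomial K :=
    ∑ n ∈ Finset.range (p.natDegree + 1), Polynomial.monomial n (D (p.coeff n)) with hq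
  have hroot : ∀ x : k, q.IsRoot (algebraMap k K x) := by
    intro x
    rw [Polynomial.IsRoot, ← h x, Polynomial.eval_eq_sum_range (p := p), map_sum, hq,
      Polynomial.eval_finsetSum]
    refine Finset.sum_congr rfl fun n _ => ?_
    rw [Polynomial.eval_monomial, ← map_pow, Derivation.leibniz, Derivation.map_algebraMap,
      smul_zero, zero_add, smul_eq_mul, mul_comm]
  have hq0 : q = 0 := by
    refine Polynomial.eq_zero_of_infinite_isRoot q
      (Set.Infinite.mono ?_ (Set.infinite_range_of_injective (algebraMap k K).injective))
    rintro _ ⟨x, rfl⟩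
    exact hroot x
  by_cases hs : s < p.natDegree + 1
  · have h1 := congrArg (fun r : Polynomial K => r.coeff s) hq0
    simp only [hq, Polynomial.finsetSum_coeff, Polynomial.coeff_monomial, Polynomial.coeff_zero]
      at h1
    rwa [Finset.sum_ite_eq', if_pos (Finset.mem_range.2 hs)] at h1
  · rw [Polynomial.coeff_eq_zero_of_natDegree_lt (by omega), map_zero]

/-! ### Both families consist of Casimir functions -/

section Casimirs

variable {N : ℕ} (i j a b : Fin N)

theorem hamiltonian_inl_genB : hamiltonian (Sum.inl (i, j)) (genB N a b) =
    rCoeff (RatFn N) i a * genB N a j * genB N i b -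
      rCoeff (RatFn N) b j * genB N i b * genB N a j :=
  (hamiltonian_coordFn _ _).trans (poissonMatrix_inl_inl _ _ _ _ _ _)

theorem hamiltonian_inl_genC : hamiltonian (Sum.inl (i, j)) (genC N a b) =
    rCoeff (RatFn N) j b * genB N i b * genC N a j -
      rCoeff (RatFn N) a i * genB N a j * genC N i b := by
  refine (hamiltonian_coordFn _ _).trans ((poissonMatrix_inl_inr _ _ _ _ _ _).trans ?_)
  ring

theorem hamiltonian_inr_genB : hamiltonian (Sum.inr (i, j)) (genB N a b) =
    rCoeff (RatFn N) i a * genC N a j * genB N i b -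
      rCoeff (RatFn N) b j * genC N i b * genB N a j :=
  (hamiltonian_coordFn _ _).trans (poissonMatrix_inr_inl _ _ _ _ _ _)

theorem hamiltonian_inr_genC : hamiltonian (Sum.inr (i, j)) (genC N a b) =
    rCoeff (RatFn N) i a * genC N a j * genC N i b -
      rCoeff (RatFn N) b j * genC N i b * genC N a j :=
  (hamiltonian_coordFn _ _).trans (poissonMatrix_inr_inr _ _ _ _ _ _)

/-- Numerator and denominator have the same eigenvalue: counting indices from 0, [i ≥ N - d] - [j <
d] = [j ≥ d] - [i < N - d], times X_{i,j}. -/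
theorem derivation_minorRatio_eq_zero (D : Derivation ℂ (RatFn N) (RatFn N))
    (X : Matrix (Fin N) (Fin N) (RatFn N))
    (hB : ∀ a b, D (genB N a b) = rCoeff (RatFn N) i a * X a j * genB N i b -
      rCoeff (RatFn N) b j * X i b * genB N a j)
    (hC : ∀ a b, D (genC N a b) = rCoeff (RatFn N) j b * X i b * genC N a j -
      rCoeff (RatFn N) a i * X a j * genC N i b) (d : ℕ) (hd : d ≤ N) :
    D (minorRatio N d hd) = 0 := by
  rw [minorRatio, Derivation.leibniz_div, derivation_minorBottomLeft D _ X i j hB,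
    derivation_minorUpperRight D _ X i j hC, Nat.sub_sub_self hd]
  simp only [smul_eq_mul]
  split_ifs <;> first | omega | ring

theorem isCasimir_minorRatio (d : ℕ) (hd : d ≤ N) : IsCasimir (minorRatio N d hd) := by
  rw [isCasimir_iff]
  rintro (⟨i, j⟩ | ⟨i, j⟩)
  · exact derivation_minorRatio_eq_zero i j _ (genB N) (hamiltonian_inl_genB i j)
      (hamiltonian_inl_genC i j) d hd
  · refine derivation_minorRatio_eq_zero i j _ (genC N) (hamiltonian_inr_genB i j) ?_ d hd
    intro a b
    rw [hamiltonian_inr_genC, rCoeff_eq_two_sub i a, rCoeff_eq_two_sub b j]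
    ring

/-- For constant x, the Hamiltonian acts on B + xC by one common pair of row and column coefficients
u and v, with u i = v j, so its determinant is invariant. -/
theorem isCasimir_pencilFn (s : ℕ) : IsCasimir (pencilFn N s) := by
  rw [isCasimir_iff]
  intro c
  refine derivation_coeff_eq_zero (k := ℂ) (hamiltonian c) ((genB N).map Polynomial.C +
    (Polynomial.X : Polynomial (RatFn N)) • (genC N).map Polynomial.C).det (fun x => ?_) s
  rw [eval_det_pencil]
  have hx : ∀ a b, hamiltonian c ((genB N + algebraMap ℂ (RatFn N) x • genC N) a b) =
      hamiltonian c (genB N a b) + algebraMap ℂ (RatFn N) x * hamiltonian c (genC N a b) := by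
    intro a b
    rw [Matrix.add_apply, Matrix.smul_apply, map_add, smul_eq_mul, Derivation.leibniz,
      Derivation.map_algebraMap, smul_zero, add_zero, smul_eq_mul]
  rcases c with ⟨i, j⟩ | ⟨i, j⟩
  · refine derivation_det_eq_zero _ _ i j (fun a => -(rCoeff (RatFn N) a i * genB N a j))
      (fun b => -(rCoeff (RatFn N) j b * genB N i b)) (fun a b => ?_) ?_
    · rw [hx, hamiltonian_inl_genB, hamiltonian_inl_genC, rCoeff_eq_two_sub i a,
        rCoeff_eq_two_sub b j]
      simp only [Matrix.add_apply, Matrix.smul_apply, smul_eq_mul]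
      ring
    · simp only [rCoeff_self]
  · refine derivation_det_eq_zero _ _ i j (fun a => rCoeff (RatFn N) i a * genC N a j)
      (fun b => rCoeff (RatFn N) b j * genC N i b) (fun a b => ?_) ?_
    · rw [hx, hamiltonian_inr_genB, hamiltonian_inr_genC]
      simp only [Matrix.add_apply, Matrix.smul_apply, smul_eq_mul]
      ring
    · simp only [rCoeff_self]

theorem minorRatio_self : minorRatio N N le_rfl = (genB N).det := by
  rw [minorRatio, minorBottomLeft_self, minorUpperRight_sub_self, div_one]

theorem minorRatio_zero : minorRatio N 0 (Nat.zero_le N) = ((genC N).det)⁻¹ := by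
  rw [minorRatio, minorBottomLeft_zero, one_div]
  congr 1
  exact minorUpperRight_self _

end Casimirs

/-! ### Corner minors of antidiagonal matrices -/

section Antidiagonal

variable {R : Type*} [CommRing R]

/-- The matrix with entries `v j` on the antidiagonal, `j` being the column. -/
def antidiagonalMatrix {N : ℕ} (v : Fin N → R) : Matrix (Fin N) (Fin N) R :=
  Matrix.of fun a b => if a = Fin.rev b then v b else 0

/-- The determinant of the permutation matrix of the longest element of the symmetric group. -/
def revSign (R : Type*) [CommRing R] (d : ℕ) : R :=
  ((Equiv.Perm.sign (Fin.revPerm (n := d)) : ℤ) : R)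

theorem det_antidiagonalMatrix {N : ℕ} (v : Fin N → R) :
    (antidiagonalMatrix v).det = revSign R N * ∏ j, v j := by
  have h : antidiagonalMatrix v = (Matrix.diagonal v).submatrix Fin.revPerm id := by
    ext a b
    rw [Matrix.submatrix_apply, Matrix.diagonal_apply, antidiagonalMatrix, Matrix.of_apply, id,
      Fin.revPerm_apply]
    by_cases hab : a = Fin.rev b
    · subst hab
      rw [if_pos rfl, if_pos (Fin.rev_rev b), Fin.rev_rev]
    · rw [if_neg hab, if_neg (fun h => hab (by rw [← h, Fin.rev_rev]))]
  rw [h, Matrix.det_permute, Matrix.det_diagonal, revSign]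

theorem minorBottomLeft_antidiagonalMatrix {N : ℕ} (v : Fin N → R) (d : ℕ) (hd : d ≤ N) :
    minorBottomLeft (antidiagonalMatrix v) d hd =
      revSign R d * ∏ j : Fin d, v ⟨j, j.2.trans_le hd⟩ := by
  rw [← det_antidiagonalMatrix, minorBottomLeft]
  congr 1
  ext a b
  simp only [Matrix.submatrix_apply, antidiagonalMatrix, Matrix.of_apply, Fin.ext_iff, Fin.val_rev]
  exact if_congr (by omega) rfl rfl

theorem minorUpperRight_antidiagonalMatrix {N : ℕ} (v : Fin N → R) (d : ℕ) (hd : d ≤ N) :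
    minorUpperRight (antidiagonalMatrix v) d hd =
      revSign R d * ∏ j : Fin d, v ⟨N - d + j, by omega⟩ := by
  rw [← det_antidiagonalMatrix, minorUpperRight]
  congr 1
  ext a b
  simp only [Matrix.submatrix_apply, antidiagonalMatrix, Matrix.of_apply, Fin.ext_iff, Fin.val_rev]
  exact if_congr (by omega) rfl rfl

theorem revSign_mul_self (d : ℕ) : revSign R d * revSign R d = 1 := by
  rw [revSign, ← Int.cast_mul, ← Units.val_mul, Int.units_mul_self, Units.val_one, Int.cast_one]

end Antidiagonal

/-! ### Recovering antidiagonal entries from the Casimirs -/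

section Generation

variable {N : ℕ} {L : Type*} [Field L] (x y : Fin N → L) (G : Subfield L)

theorem revSign_mem (d : ℕ) : revSign L d ∈ G := intCast_mem G _

theorem revSign_ne_zero (d : ℕ) : revSign L d ≠ 0 :=
  left_ne_zero_of_mul_eq_one (revSign_mul_self d)

/-- The quotient of the ratios for d = j + 1 and d = j is x_j y_j, up to a sign. -/
theorem mul_mem_of_minor_ratio_mem (hx : ∀ j, x j ≠ 0) (hy : ∀ j, y j ≠ 0)
    (hr : ∀ (d : ℕ) (hd : d ≤ N), minorBottomLeft (antidiagonalMatrix x) d hd /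
      minorUpperRight (antidiagonalMatrix y) (N - d) (Nat.sub_le N d) ∈ G) (j : Fin N) :
    x j * y j ∈ G := by
  -- The size m is kept separate from N - d so that it can be instantiated as N - (j + 1) + 1, from
  -- which a factor can be split off.
  have key : ∀ (d m : ℕ) (hd : d ≤ N) (hm : m ≤ N), m = N - d →
      (∏ j : Fin d, x ⟨j, j.2.trans_le hd⟩) / ∏ j : Fin m, y ⟨N - m + j, by omega⟩ ∈ G := by
    rintro d m hd hm rfl
    have h := mul_mem (hr d hd) (div_mem (revSign_mem G (N - d)) (revSign_mem G d))
    rw [minorBottomLeft_antidiagonalMatrix, minorUpperRight_antidiagonalMatrix] at h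
    convert! h using 1
    have h1 := revSign_ne_zero (L := L) d
    have h2 := revSign_ne_zero (L := L) (N - d)
    have h3 : (∏ j : Fin (N - d), y ⟨N - (N - d) + j, by omega⟩) ≠ 0 :=
      Finset.prod_ne_zero_iff.2 fun _ _ => hy _
    field_simp
  have h := div_mem (key (j + 1) (N - (j + 1)) (by omega) (by omega) rfl)
    (key j (N - (j + 1) + 1) (by omega) (by omega) (by omega))
  rw [Fin.prod_univ_castSucc, Fin.prod_univ_succ] at h
  convert! h using 1
  have e1 : (∏ i : Fin j, x ⟨i, by omega⟩) ≠ 0 :=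
    Finset.prod_ne_zero_iff.2 fun _ _ => hx _
  have e2 : (∏ i : Fin (N - (j + 1)), y ⟨N - (N - (j + 1)) + i, by omega⟩) ≠ 0 :=
    Finset.prod_ne_zero_iff.2 fun _ _ => hy _
  have e3 : (∏ i : Fin (N - (j + 1)), y ⟨N - (N - (j + 1) + 1) + (Fin.succ i : Fin (_ + 1)),
      by simp; omega⟩) = ∏ i : Fin (N - (j + 1)), y ⟨N - (N - (j + 1)) + i, by omega⟩ := by
    refine Finset.prod_congr rfl fun i _ => ?_
    congr 1
    exact Fin.ext (by simp; omega)
  have e4 : (⟨(Fin.last (j : ℕ) : Fin (j + 1)), by simp⟩ : Fin N) = j := Fin.ext rfl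
  have e5 : (⟨N - (N - (j + 1) + 1) + ((0 : Fin (N - (j + 1) + 1)) : ℕ), by simp; omega⟩ : Fin N)
      = j := Fin.ext (by simp; omega)
  rw [e3, e4, e5]
  simp only [Fin.val_castSucc]
  have := hy j
  field_simp

/-- A subfield, algebraically closed in `L`, which contains the values at a pair of antidiagonal
matrices of the minor ratios and of the coefficients of the characteristic pencil contains the
entries of the two matrices. -/
theorem entries_mem_of_casimirs_mem (hx : ∀ j, x j ≠ 0) (hy : ∀ j, y j ≠ 0)
    (hG : ∀ p : Polynomial L, p ≠ 0 → (∀ n, p.coeff n ∈ G) → ∀ z, p.IsRoot z → z ∈ G)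
    (hr : ∀ (d : ℕ) (hd : d ≤ N), minorBottomLeft (antidiagonalMatrix x) d hd /
      minorUpperRight (antidiagonalMatrix y) (N - d) (Nat.sub_le N d) ∈ G)
    (hq : ∀ s : ℕ, s + 1 < N →
      pencilCoeff (antidiagonalMatrix x) (antidiagonalMatrix y) (s + 1) ∈ G) (j : Fin N) :
    x j ∈ G ∧ y j ∈ G := by
  have hxy := mul_mem_of_minor_ratio_mem x y G hx hy hr j
  have hdety : (antidiagonalMatrix y).det ≠ 0 := by
    rw [det_antidiagonalMatrix]
    exact mul_ne_zero (revSign_ne_zero N) (Finset.prod_ne_zero_iff.2 fun _ _ => hy _)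
  -- The end coefficients come from the ratios: s = 0 from d = N, and s = N from the inverse of the
  -- one for d = 0.
  have hq' : ∀ s, pencilCoeff (antidiagonalMatrix x) (antidiagonalMatrix y) s ∈ G := by
    intro s
    rcases Nat.eq_zero_or_pos s with rfl | hs
    · have := hr N le_rfl
      rwa [minorBottomLeft_self, minorUpperRight_sub_self, div_one, ← pencilCoeff_zero _
        (antidiagonalMatrix y)] at this
    rcases lt_trichotomy s N with h | rfl | h
    · have := hq (s - 1) (by omega)
      rwa [Nat.sub_add_cancel hs] at this
    · have h0 := inv_mem (hr 0 (Nat.zero_le _))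
      rw [minorBottomLeft_zero, one_div, inv_inv] at h0
      rw [pencilCoeff_self]
      convert! h0 using 1
      exact (minorUpperRight_self _).symm
    · have := Polynomial.natDegree_det_X_add_C_le (antidiagonalMatrix y) (antidiagonalMatrix x)
      rw [Fintype.card_fin, add_comm] at this
      rw [pencilCoeff, Polynomial.coeff_eq_zero_of_natDegree_lt (by omega)]
      exact zero_mem G
  have hroot : -(x j / y j) ∈ G := by
    refine hG ((antidiagonalMatrix x).map Polynomial.C +
      (Polynomial.X : Polynomial L) • (antidiagonalMatrix y).map Polynomial.C).det ?_ hq' _ ?_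
    · intro h0
      apply hdety
      rw [← pencilCoeff_self (antidiagonalMatrix x), pencilCoeff, h0, Polynomial.coeff_zero]
    · rw [Polynomial.IsRoot, eval_det_pencil]
      have : antidiagonalMatrix x + (-(x j / y j)) • antidiagonalMatrix y =
          antidiagonalMatrix fun i => x i + (-(x j / y j)) * y i := by
        ext a b
        simp only [antidiagonalMatrix, Matrix.add_apply, Matrix.smul_apply, Matrix.of_apply,
          smul_eq_mul]
        split_ifs <;> simp
      rw [this, det_antidiagonalMatrix, Finset.prod_eq_zero (Finset.mem_univ j), mul_zero]
      have := hy j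
      field_simp
      ring
  have hsq : x j ^ 2 ∈ G := by
    have h := mul_mem hxy (neg_mem hroot)
    convert! h using 1
    have := hy j
    field_simp
  have hxG : x j ∈ G := by
    refine hG (Polynomial.X ^ 2 - Polynomial.C (x j ^ 2))
      (Polynomial.X_pow_sub_C_ne_zero two_pos _) (fun n => ?_) _ (by simp)
    rw [Polynomial.coeff_sub, Polynomial.coeff_X_pow, Polynomial.coeff_C]
    refine sub_mem ?_ ?_
    · split_ifs
      exacts [one_mem G, zero_mem G]
    · split_ifs
      exacts [hsq, zero_mem G]
  refine ⟨hxG, ?_⟩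
  have h := div_mem hxy hxG
  rwa [mul_div_cancel_left₀ _ (hx j)] at h

end Generation

/-! ### Algebraic independence of the 2N Casimirs -/

section Independence

variable (N : ℕ)

/-- The field of rational functions of the entries of two antidiagonal matrices. -/
abbrev AntidiagFn : Type := FractionRing (MvPolynomial (Fin N ⊕ Fin N) ℂ)

/-- The coordinates on the pairs of antidiagonal matrices. -/
noncomputable def antidiagCoord (a : Fin N ⊕ Fin N) : AntidiagFn N :=
  algebraMap (MvPolynomial (Fin N ⊕ Fin N) ℂ) (AntidiagFn N) (MvPolynomial.X a)

theorem antidiagCoord_ne_zero (a : Fin N ⊕ Fin N) : antidiagCoord N a ≠ 0 := by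
  rw [antidiagCoord, Ne, map_eq_zero_iff _ (IsFractionRing.injective _ _)]
  exact MvPolynomial.X_ne_zero a

/-- The generic antidiagonal matrix `B`. -/
noncomputable def antidiagB : Matrix (Fin N) (Fin N) (AntidiagFn N) :=
  antidiagonalMatrix fun j => antidiagCoord N (Sum.inl j)

/-- The generic antidiagonal matrix `C`. -/
noncomputable def antidiagC : Matrix (Fin N) (Fin N) (AntidiagFn N) :=
  antidiagonalMatrix fun j => antidiagCoord N (Sum.inr j)

/-- The restrictions of the `2 N` Casimir functions to the pairs of antidiagonal matrices. -/
noncomputable def antidiagCasimir : Fin (N + 1) ⊕ Fin (N - 1) → AntidiagFn N :=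
  Sum.elim
    (fun d => minorBottomLeft (antidiagB N) d (Nat.lt_succ_iff.mp d.isLt) /
      minorUpperRight (antidiagC N) (N - d) (Nat.sub_le N d))
    (fun s => pencilCoeff (antidiagB N) (antidiagC N) (s + 1))

open scoped IntermediateField.algebraAdjoinAdjoin in
-- A field of transcendence degree 2N that is algebraic over the subfield generated by 2N elements
-- has them as a transcendence basis.
theorem algebraicIndependent_antidiagCasimir (hN : 1 ≤ N) :
    AlgebraicIndependent ℂ (antidiagCasimir N) := by
  set S := Set.range (antidiagCasimir N)
  let E := IntermediateField.adjoin ℂ S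
  let G := algebraicClosure E (AntidiagFn N)
  have hSG : ∀ a, antidiagCasimir N a ∈ G := fun a =>
    G.algebraMap_mem ⟨_, IntermediateField.subset_adjoin ℂ S ⟨a, rfl⟩⟩
  have hG : ∀ p : Polynomial (AntidiagFn N), p ≠ 0 → (∀ n, p.coeff n ∈ G.toSubfield) →
      ∀ z, p.IsRoot z → z ∈ G.toSubfield := by
    intro p hp hc z hz
    have : p ∈ Polynomial.lifts (algebraMap G (AntidiagFn N)) :=
      (Polynomial.lifts_iff_coeff_lifts p).2 fun n => ⟨⟨_, hc n⟩, rfl⟩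
    obtain ⟨q, rfl⟩ := (Polynomial.mem_lifts p).1 this
    have hz' : IsAlgebraic G z := by
      refine ⟨q, fun h => hp (by rw [h, Polynomial.map_zero]), ?_⟩
      rwa [Polynomial.IsRoot, Polynomial.eval_map_algebraMap] at hz
    exact mem_algebraicClosure_iff.2 (hz'.restrictScalars E)
  have hmem := entries_mem_of_casimirs_mem (fun j => antidiagCoord N (Sum.inl j))
    (fun j => antidiagCoord N (Sum.inr j)) G.toSubfield
    (fun _ => antidiagCoord_ne_zero N _) (fun _ => antidiagCoord_ne_zero N _) hG
    (fun d hd => hSG (Sum.inl ⟨d, by omega⟩)) (fun s hs => hSG (Sum.inr ⟨s, by omega⟩))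
  have hpoly : ∀ p : MvPolynomial (Fin N ⊕ Fin N) ℂ, algebraMap _ (AntidiagFn N) p ∈ G := by
    intro p
    induction p using MvPolynomial.induction_on with
    | C c =>
      have : algebraMap (MvPolynomial (Fin N ⊕ Fin N) ℂ) (AntidiagFn N) (MvPolynomial.C c) =
          algebraMap E (AntidiagFn N) (algebraMap ℂ E c) := by
        rw [← MvPolynomial.algebraMap_eq, ← IsScalarTower.algebraMap_apply,
          ← IsScalarTower.algebraMap_apply]
      rw [this]
      exact G.algebraMap_mem _
    | add p q hp hq => rw [map_add]; exact add_mem hp hq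
    | mul_X p a hp =>
      rw [map_mul]
      refine mul_mem hp ?_
      rcases a with j | j
      exacts [(hmem j).1, (hmem j).2]
  have halg : Algebra.IsAlgebraic E (AntidiagFn N) := ⟨fun z => by
    obtain ⟨n, d, -, rfl⟩ := IsFractionRing.div_surjective
      (A := MvPolynomial (Fin N ⊕ Fin N) ℂ) z
    exact mem_algebraicClosure_iff.1 (div_mem (hpoly n) (hpoly d))⟩
  have : Algebra.IsAlgebraic (Algebra.adjoin ℂ S) (AntidiagFn N) :=
    (IsFractionRing.comap_isAlgebraic_iff (A := Algebra.adjoin ℂ S) (K := E)).2 halg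
  refine (Algebra.IsAlgebraic.isTranscendenceBasis_of_le_trdeg_of_finite ℂ
    (antidiagCasimir N) ?_).1
  rw [trdeg_fractionRing_mvPolynomial, Cardinal.mk_fintype]
  simp only [Fintype.card_sum, Fintype.card_fin]
  -- N ≥ 1 matters here: for N = 0, truncated subtraction would leave one function in degree 0.
  exact_mod_cast (by omega : N + 1 + (N - 1) ≤ N + N)

/-- The matrix `B` of coordinates, as polynomials. -/
noncomputable def polyB : Matrix (Fin N) (Fin N) (Poly N) :=
  Matrix.of fun i j => MvPolynomial.X (Sum.inl (i, j))

/-- The matrix `C` of coordinates, as polynomials. -/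
noncomputable def polyC : Matrix (Fin N) (Fin N) (Poly N) :=
  Matrix.of fun i j => MvPolynomial.X (Sum.inr (i, j))

theorem polyB_map : (polyB N).map (algebraMap (Poly N) (RatFn N)) = genB N := rfl

theorem polyC_map : (polyC N).map (algebraMap (Poly N) (RatFn N)) = genC N := rfl

/-- Restriction to antidiagonal pairs is an admissible specialization, since the denominators become
monomials up to sign. -/
theorem algebraicIndependent_casimirs (hN : 1 ≤ N) :
    AlgebraicIndependent ℂ
      (Sum.elim
        (fun d : Fin (N + 1) => minorRatio N d (Nat.lt_succ_iff.mp d.isLt))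
        (fun s : Fin (N - 1) => pencilFn N (s + 1))) := by
  let φ : Poly N →ₐ[ℂ] AntidiagFn N := MvPolynomial.aeval
    (Sum.elim (fun p => antidiagB N p.1 p.2) (fun p => antidiagC N p.1 p.2))
  have hB : (polyB N).map φ = antidiagB N := by ext i j; simp [φ, polyB]
  have hC : (polyC N).map φ = antidiagC N := by ext i j; simp [φ, polyC]
  let n : Fin (N + 1) ⊕ Fin (N - 1) → Poly N := Sum.elim
    (fun d => minorBottomLeft (polyB N) d (Nat.lt_succ_iff.mp d.isLt))
    (fun s => pencilCoeff (polyB N) (polyC N) (s + 1))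
  let e : Fin (N + 1) ⊕ Fin (N - 1) → Poly N := Sum.elim
    (fun d => minorUpperRight (polyC N) (N - d) (Nat.sub_le N d)) (fun _ => 1)
  have hφ : ∀ d hd, φ (minorUpperRight (polyC N) d hd) = minorUpperRight (antidiagC N) d hd :=
    fun d hd => (minorUpperRight_map _ φ.toRingHom d hd).trans (congrArg (minorUpperRight · d hd) hC)
  have key := AlgebraicIndependent.of_specialization (K := RatFn N) φ n e ?_ ?_
  · convert! key using 1
    funext a
    rcases a with d | s
    · change minorRatio _ d (Nat.lt_succ_iff.mp d.isLt) = _ / _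
      rw [minorRatio, ← polyB_map, ← polyC_map, ← minorBottomLeft_map, ← minorUpperRight_map]
      rfl
    · change pencilFn _ _ = _ / algebraMap _ _ 1
      rw [pencilFn, ← polyB_map, ← polyC_map, ← pencilCoeff_map, map_one, div_one]
      rfl
  · rintro (d | s)
    · change φ (minorUpperRight _ (N - d) (Nat.sub_le N d)) ≠ 0
      rw [hφ, antidiagC, minorUpperRight_antidiagonalMatrix]
      exact mul_ne_zero (revSign_ne_zero _)
        (Finset.prod_ne_zero_iff.2 fun _ _ => antidiagCoord_ne_zero N _)
    · change φ 1 ≠ 0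
      rw [map_one]
      exact one_ne_zero
  · convert! algebraicIndependent_antidiagCasimir N hN using 1
    funext a
    rcases a with d | s
    · change φ (minorBottomLeft _ d (Nat.lt_succ_iff.mp d.isLt)) / φ (minorUpperRight _ (N - d) (Nat.sub_le N d)) = _
      rw [hφ]
      have := (minorBottomLeft_map (polyB N) φ.toRingHom d (Nat.lt_succ_iff.mp d.isLt)).trans
        (congrArg (minorBottomLeft · d (Nat.lt_succ_iff.mp d.isLt)) hB)
      exact congrArg (· / minorUpperRight (antidiagC N) (N - d) (Nat.sub_le N d)) this
    · change φ (pencilCoeff _ _ _) / φ 1 = _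
      rw [map_one, div_one]
      refine (pencilCoeff_map φ.toRingHom (polyB N) (polyC N) (s + 1)).trans ?_
      exact congrArg₂ (pencilCoeff · · (s + 1)) hB hC

end Independence

/-! ### The Poisson tensor at an antidiagonal point -/

section SpecialPoint

variable {N : ℕ}

theorem rCoeff_rev_rev {R : Type*} [CommRing R] (a j : Fin N) :
    rCoeff R (Fin.rev a) (Fin.rev j) = rCoeff R j a := by
  unfold rCoeff
  simp only [Fin.rev_inj, Fin.rev_lt_rev, eq_comm]

variable {R : Type*} [CommRing R]

theorem antidiagonalMatrix_mul_eq_zero (x y : Fin N → R) {a j k l : Fin N}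
    (h : (k, l) ≠ (Fin.rev j, a)) :
    antidiagonalMatrix x k j * antidiagonalMatrix y (Fin.rev a) l = 0 := by
  simp only [antidiagonalMatrix, Matrix.of_apply]
  by_cases hk : k = Fin.rev j
  · rw [if_neg (c := Fin.rev a = Fin.rev l), mul_zero]
    intro hl
    exact h (Prod.ext hk (Fin.rev_injective hl).symm)
  · rw [if_neg hk, zero_mul]

theorem rBracket_antidiagonal (x y : Fin N → R) (a j : Fin N) (p : Fin N × Fin N) :
    rBracket (antidiagonalMatrix x) (antidiagonalMatrix y) (Fin.rev a, p.1) (j, p.2) =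
      if p = (Fin.rev j, a) then rCoeff R j a * (x j * y a) - rCoeff R a j * (x a * y j)
      else 0 := by
  rw [rBracket_apply]
  split_ifs with h
  · subst h
    simp only [antidiagonalMatrix, Matrix.of_apply, if_true, rCoeff_rev_rev]
    ring
  · have h1 := antidiagonalMatrix_mul_eq_zero x y h
    have h2 := antidiagonalMatrix_mul_eq_zero y x h
    linear_combination rCoeff R (Fin.rev a) p.1 * h1 - rCoeff R p.2 j * h2

theorem rBracket_antidiagonal_swap (x y : Fin N → R) (a j : Fin N) (p : Fin N × Fin N) :
    rBracket (antidiagonalMatrix x) (antidiagonalMatrix y) (p.1, Fin.rev a) (p.2, j) =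
      if p = (Fin.rev j, a) then rCoeff R a j * (x a * y j) - rCoeff R j a * (x j * y a)
      else 0 := by
  rw [rBracket_apply]
  split_ifs with h
  · subst h
    simp only [antidiagonalMatrix, Matrix.of_apply, if_true, rCoeff_rev_rev]
    ring
  · have h1 := antidiagonalMatrix_mul_eq_zero x y h
    have h2 := antidiagonalMatrix_mul_eq_zero y x h
    linear_combination rCoeff R p.1 (Fin.rev a) * h2 - rCoeff R j p.2 * h1

/-- At a pair of antidiagonal matrices, the Poisson tensor pairs the coordinates at mirror
positions only. -/
theorem poissonMatrix_antidiagonal_mulVec (x y : Fin N → R) (a j : Fin N) (v : Coord N → R) :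
    (poissonMatrix (antidiagonalMatrix x) (antidiagonalMatrix y)).mulVec v
        (Sum.inl (Fin.rev a, j)) =
      (rCoeff R j a * (x j * x a) - rCoeff R a j * (x a * x j)) * v (Sum.inl (Fin.rev j, a)) -
      (rCoeff R a j * (y a * x j) - rCoeff R j a * (y j * x a)) * v (Sum.inr (Fin.rev j, a)) ∧
    (poissonMatrix (antidiagonalMatrix x) (antidiagonalMatrix y)).mulVec v
        (Sum.inr (Fin.rev a, j)) =
      (rCoeff R j a * (y j * x a) - rCoeff R a j * (y a * x j)) * v (Sum.inl (Fin.rev j, a)) +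
      (rCoeff R j a * (y j * y a) - rCoeff R a j * (y a * y j)) * v (Sum.inr (Fin.rev j, a)) := by
  constructor
  · rw [Matrix.mulVec, dotProduct, Fintype.sum_sum_type,
      Finset.sum_eq_single (Fin.rev j, a), Finset.sum_eq_single (Fin.rev j, a), sub_eq_add_neg]
    · congr 1
      · exact congrArg (· * _) ((rBracket_antidiagonal x x a j _).trans (if_pos rfl))
      · rw [← neg_mul]
        exact congrArg (-· * _) ((rBracket_antidiagonal_swap y x a j _).trans (if_pos rfl))
    · intro p _ hp
      refine mul_eq_zero_of_left (neg_eq_zero.2 ?_) _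
      exact (rBracket_antidiagonal_swap y x a j p).trans (if_neg hp)
    · simp
    · intro p _ hp
      refine mul_eq_zero_of_left ?_ _
      exact (rBracket_antidiagonal x x a j p).trans (if_neg hp)
    · simp
  · rw [Matrix.mulVec, dotProduct, Fintype.sum_sum_type,
      Finset.sum_eq_single (Fin.rev j, a), Finset.sum_eq_single (Fin.rev j, a)]
    · congr 1
      · exact congrArg (· * _) ((rBracket_antidiagonal y x a j _).trans (if_pos rfl))
      · exact congrArg (· * _) ((rBracket_antidiagonal y y a j _).trans (if_pos rfl))
    · intro p _ hp
      refine mul_eq_zero_of_left ?_ _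
      exact (rBracket_antidiagonal y y a j p).trans (if_neg hp)
    · simp
    · intro p _ hp
      refine mul_eq_zero_of_left ?_ _
      exact (rBracket_antidiagonal y x a j p).trans (if_neg hp)
    · simp

/-- At a pair of antidiagonal matrices `B` and `C` such that `B⁻¹ C` has a simple spectrum, the
corank of the Poisson tensor is at most `2 N`. -/
theorem corank_antidiagonal_le {k : Type*} [Field k] [CharZero k] (x : Fin N → k)
    (hx : ∀ j, x j ≠ 0) (hinj : Function.Injective x) :
    corank (poissonMatrix (antidiagonalMatrix x) (antidiagonalMatrix fun _ => (1 : k))) ≤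
      2 * N := by
  set M := poissonMatrix (antidiagonalMatrix x) (antidiagonalMatrix fun _ => (1 : k)) with hM
  have hoff : ∀ v : Coord N → k, M.mulVec v = 0 → ∀ a j, a ≠ j →
      v (Sum.inl (Fin.rev j, a)) = 0 ∧ v (Sum.inr (Fin.rev j, a)) = 0 := by
    intro v hv a j haj
    obtain ⟨h1, h2⟩ := poissonMatrix_antidiagonal_mulVec x (fun _ => (1 : k)) a j v
    rw [← hM, hv, Pi.zero_apply] at h1 h2
    generalize v (Sum.inl (Fin.rev j, a)) = p at *
    generalize v (Sum.inr (Fin.rev j, a)) = q at *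
    -- The two equations form a linear system in p and q whose determinant is x_j - x_a up to a
    -- nonzero factor.
    have hne : x j - x a ≠ 0 := sub_ne_zero.2 fun h => haj (hinj h).symm
    rcases lt_or_gt_of_ne haj with h | h
    · rw [rCoeff_of_lt h, rCoeff_of_gt h] at h1 h2
      have hp : p = 0 := by
        have : 2 * x a * (x j - x a) * p = 0 := by linear_combination -h1 + x a * h2
        simpa [hx a, hne] using this
      refine ⟨hp, ?_⟩
      rw [hp] at h2
      simpa using h2.symm
    · rw [rCoeff_of_lt h, rCoeff_of_gt h] at h1 h2
      have hp : p = 0 := by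
        have : 2 * x j * (x j - x a) * p = 0 := by linear_combination -h1 + x j * h2
        simpa [hx j, hne] using this
      refine ⟨hp, ?_⟩
      rw [hp] at h2
      simpa using h2.symm
  -- Kernel vectors vanish off the antidiagonals, so restriction to the 2N antidiagonal coordinates
  -- is injective on the kernel.
  let r : (Coord N → k) →ₗ[k] (Fin N ⊕ Fin N → k) := LinearMap.funLeft k k
    (Sum.map (fun j => (Fin.rev j, j)) fun j => (Fin.rev j, j))
  have hr : Function.Injective (r ∘ₗ (LinearMap.ker M.mulVecLin).subtype) := by
    rw [← LinearMap.ker_eq_bot, LinearMap.ker_eq_bot']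
    rintro ⟨v, hv⟩ h0
    have hv' : M.mulVec v = 0 := hv
    refine Subtype.ext (funext fun c => ?_)
    rcases c with ⟨i, a⟩ | ⟨i, a⟩
    · by_cases hia : i = Fin.rev a
      · subst hia
        exact congrFun h0 (Sum.inl a)
      · have := (hoff v hv' a (Fin.rev i) fun h => hia (by rw [h, Fin.rev_rev])).1
        rwa [Fin.rev_rev] at this
    · by_cases hia : i = Fin.rev a
      · subst hia
        exact congrFun h0 (Sum.inr a)
      · have := (hoff v hv' a (Fin.rev i) fun h => hia (by rw [h, Fin.rev_rev])).2
        rwa [Fin.rev_rev] at this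
  calc corank M ≤ Module.finrank k (Fin N ⊕ Fin N → k) :=
        LinearMap.finrank_le_finrank_of_injective hr
    _ = 2 * N := by
        rw [Module.finrank_fintype_fun_eq_card, Fintype.card_sum, Fintype.card_fin, two_mul]

end SpecialPoint

/-! ### The generic corank -/

section GenericCorank

variable (N : ℕ)

theorem poissonMatrix_poly_map_algebraMap :
    (poissonMatrix (polyB N) (polyC N)).map (algebraMap (Poly N) (RatFn N)) =
      poissonMatrix (genB N) (genC N) := by
  rw [poissonMatrix_map, polyB_map, polyC_map]

theorem poissonMatrix_poly_map_eval {N : ℕ} (B C : Matrix (Fin N) (Fin N) ℂ) :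
    (poissonMatrix (polyB N) (polyC N)).map (MvPolynomial.eval (point B C)) =
      poissonMatrix B C := by
  rw [poissonMatrix_map]
  congr 1 <;> ext i j <;> simp [polyB, polyC, point]

/-- The corank at a point is at least the corank over the field of rational functions. -/
theorem corank_generic_le (B C : Matrix (Fin N) (Fin N) ℂ) :
    corank (poissonMatrix (genB N) (genC N)) ≤ corank (poissonMatrix B C) := by
  obtain ⟨F, hF, h⟩ := exists_ne_zero_forall_rank_le (poissonMatrix (polyB N) (polyC N)) (point B C)
  have hr := h (algebraMap (Poly N) (RatFn N)) (by simpa using hF)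
  rw [poissonMatrix_poly_map_eval, poissonMatrix_poly_map_algebraMap] at hr
  have h1 := rank_add_corank (poissonMatrix B C)
  have h2 := rank_add_corank (poissonMatrix (genB N) (genC N))
  omega

theorem exists_ne_zero_forall_corank_le : ∃ F : Poly N, F ≠ 0 ∧
    ∀ B C : Matrix (Fin N) (Fin N) ℂ, MvPolynomial.eval (point B C) F ≠ 0 →
      corank (poissonMatrix B C) ≤ 2 * N := by
  -- Any distinct nonzero values would serve.
  let x : Fin N → ℂ := fun j => ((j : ℕ) : ℂ) + 1
  have hs := corank_antidiagonal_le x (fun j => Nat.cast_add_one_ne_zero _) (fun i j h => by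
    simpa [x, Fin.ext_iff] using h)
  obtain ⟨F, hF, h⟩ := exists_ne_zero_forall_rank_le (poissonMatrix (polyB N) (polyC N))
    (point (antidiagonalMatrix x) (antidiagonalMatrix fun _ => 1))
  refine ⟨F, hF, fun B C hBC => ?_⟩
  have hr := h (MvPolynomial.eval (point B C)) hBC
  rw [poissonMatrix_poly_map_eval, poissonMatrix_poly_map_eval] at hr
  have h1 := rank_add_corank (poissonMatrix B C)
  have h2 := rank_add_corank (poissonMatrix (antidiagonalMatrix x) (antidiagonalMatrix fun _ => 1))
  omega

theorem corank_generic_le_two_mul : corank (poissonMatrix (genB N) (genC N)) ≤ 2 * N := by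
  let x : Fin N → ℂ := fun j => ((j : ℕ) : ℂ) + 1
  exact (corank_generic_le N _ _).trans
    (corank_antidiagonal_le x (fun j => Nat.cast_add_one_ne_zero _) (fun i j h => by
      simpa [x, Fin.ext_iff] using h))

theorem isCasimir_casimirs (a : Fin (N + 1) ⊕ Fin (N - 1)) :
    IsCasimir (Sum.elim
      (fun d : Fin (N + 1) => minorRatio N d (Nat.lt_succ_iff.mp d.isLt))
      (fun s : Fin (N - 1) => pencilFn N (s + 1)) a) := by
  rcases a with d | s
  exacts [isCasimir_minorRatio _ _, isCasimir_pencilFn _]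

/-- The (N + 1) + (N - 1) independent Casimirs supply the kernel vectors. -/
theorem two_mul_le_corank_generic (hN : 1 ≤ N) :
    2 * N ≤ corank (poissonMatrix (genB N) (genC N)) := by
  have h := card_le_corank (isCasimir_casimirs N) (algebraicIndependent_casimirs N hN)
  rw [Fintype.card_sum, Fintype.card_fin, Fintype.card_fin] at h
  omega

end GenericCorank

end BCSystem

theorem lemma5p1 (N : ℕ) (hN : 1 ≤ N) :
    -- the two kinds of Casimir functions
    (∀ (d : ℕ) (hd : d ≤ N), BCSystem.IsCasimir (BCSystem.minorRatio N d hd)) ∧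
    (∀ s : ℕ, s ≤ N → BCSystem.IsCasimir (BCSystem.pencilFn N s)) ∧
    -- `det B` and `det C` enter both sets
    BCSystem.minorRatio N N le_rfl = (BCSystem.genB N).det ∧
    BCSystem.pencilFn N 0 = (BCSystem.genB N).det ∧
    BCSystem.minorRatio N 0 (Nat.zero_le N) = ((BCSystem.genC N).det)⁻¹ ∧
    BCSystem.pencilFn N N = (BCSystem.genC N).det ∧
    -- the other `(N + 1) + (N - 1) = 2 N` functions are algebraically independent
    AlgebraicIndependent ℂ
      (Sum.elim
        (fun d : Fin (N + 1) => BCSystem.minorRatio N d (Nat.lt_succ_iff.mp d.isLt))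
        (fun s : Fin (N - 1) => BCSystem.pencilFn N (s + 1))) ∧
    -- there are no more than `2 N` algebraically independent Casimir functions
    (∀ (n : ℕ) (f : Fin n → BCSystem.RatFn N), (∀ i, BCSystem.IsCasimir (f i)) →
      AlgebraicIndependent ℂ f → n ≤ 2 * N) ∧
    -- the generic corank of the bracket is `2 N`
    (∃ F : BCSystem.Poly N, F ≠ 0 ∧
      ∀ B C : Matrix (Fin N) (Fin N) ℂ, MvPolynomial.eval (BCSystem.point B C) F ≠ 0 →
        BCSystem.corank (BCSystem.poissonMatrix B C) = 2 * N) := by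
  refine ⟨BCSystem.isCasimir_minorRatio, fun s _ => BCSystem.isCasimir_pencilFn s,
    BCSystem.minorRatio_self, BCSystem.pencilCoeff_zero _ _, BCSystem.minorRatio_zero,
    BCSystem.pencilCoeff_self _ _, BCSystem.algebraicIndependent_casimirs N hN, ?_, ?_⟩
  · intro n f hf hind
    have h := BCSystem.card_le_corank hf hind
    rw [Fintype.card_fin] at h
    exact h.trans (BCSystem.corank_generic_le_two_mul N)
  · obtain ⟨F, hF, h⟩ := BCSystem.exists_ne_zero_forall_corank_le N
    exact ⟨F, hF, fun B C hBC => le_antisymm (h B C hBC)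
      ((BCSystem.two_mul_le_corank_generic N hN).trans (BCSystem.corank_generic_le N B C))⟩
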